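/- An index is a finite sequence $\mathbf{k}=(k_1,\ldots,k_r)$ of positive integers; all operations below are extended $\mathbb{Q}$-linearly to formal $\mathbb{Q}$-linear combinations of indices. Put $$\zeta(k_1,\ldots,k_r)=\sum_{0<n_1<\cdots<n_r}\frac{1}{n_1^{k_1}\cdots n_r^{k_r}}$$ whenever this series converges, and let $(1^m)=(1,\ldots,1)$ with $m$ entries. - The stuffle product $*$ is the bilinear product on formal sums of indices with $\varnothing*\mathbf{l}=\mathbf{l}$, $\mathbf{k}*\varnothing=\mathbf{k}$ and $(a,\mathbf{k})*(b,\mathbf{l})=(a,\mathbf{k}*(b,\mathbf{l}))+(b,(a,\mathbf{k})*\mathbf{l})+(a+b,\mathbf{k}*\mathbf{l})$. The product $\bar*$ (the stuffle product for multiple zeta-star values) is defined by the same rules, except that the last term has the sign $-$. - For non-empty indices, $\mathbf{k}\circledast\mathbf{l}=\bigl((k_1,\ldots,k_{r-1})*(l_1,\ldots,l_{s-1}),\,k_r+l_s\bigr)$. - $\mathbf{l}^\star$ is the formal sum of the $2^{s-1}$ indices $(l_1\,\square\cdots\square\, l_s)$, where each $\square$ is a comma or a plus. - $\mathbf{k}^\vee$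 is the Hoffman dual of a non-empty index $\mathbf{k}$: write each entry as $1+\cdots+1$ and interchange all commas and pluses. **Kawashima's relation.** Let $m\ge1$ and let $\mathbf{k},\mathbf{l}$ be non-empty indices. Then $$\sum_{\substack{p+q=m\\ p,q\ge1}}\zeta\bigl((1^p)\circledast(\mathbf{k}^\vee)^\star\bigr)\,\zeta\bigl((1^q)\circledast(\mathbf{l}^\vee)^\star\bigr)=-\zeta\bigl((1^m)\circledast((\mathbf{k}\mathbin{\bar*}\mathbf{l})^\vee)^\star\bigr).$$ Here all multiple zeta series that occur converge: for every $p\ge1$ they converge for each index occurring in $(1^p)\circledast(\mathbf{k}^\vee)^\star$, in $(1^p)\circledast(\mathbf{l}^\vee)^\star$ and in $(1^p)\circledast((\mathbf{k}\mathbin{\bar*}\mathbf{l})^\vee)^\star$. -/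

import Mathlib

namespace MZV

noncomputable section

/-- An index `(k₁, …, k_r)`: a finite (possibly empty) sequence of positive integers. -/
abbrev Index : Type := List ℕ+

/-- Formal `ℚ`-linear combinations of indices. -/
abbrev FormalSum : Type := Index →₀ ℚ

/-- The index `(1, …, 1)` with `m` entries. -/
def ones (m : ℕ) : Index := List.replicate m 1

/-! ### Multiple zeta values -/

/-- The term `1 / (n₁ ^ k₁ ⋯ n_r ^ k_r)` at a tuple `0 < n₁ < ⋯ < n_r`. -/
def zetaTerm (k : Index) (n : {n : Fin k.length → ℕ+ // StrictMono n}) : ℝ :=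
  ∏ i, 1 / ((n.1 i : ℕ) : ℝ) ^ (k.get i : ℕ)

/-- The multiple zeta value `ζ(k) = ∑_{0 < n₁ < ⋯ < n_r} 1 / (n₁ ^ k₁ ⋯ n_r ^ k_r)`. -/
def zetaIndex (k : Index) : ℝ := ∑' n, zetaTerm k n

/-- `ζ` extended `ℚ`-linearly to formal sums of indices. -/
def zeta : FormalSum →ₗ[ℚ] ℝ := Finsupp.linearCombination ℚ zetaIndex

/-- Every multiple zeta series that occurs in the formal sum `A` converges. -/
def Converges (A : FormalSum) : Prop := ∀ k ∈ A.support, Summable (zetaTerm k)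

/-! ### Products of indices -/

/-- Linear extension of `(k₁, …, k_r) ↦ (a, k₁, …, k_r)`. -/
def prepend (a : ℕ+) : FormalSum →ₗ[ℚ] FormalSum := Finsupp.lmapDomain ℚ ℚ (List.cons a)

/-- Linear extension of `(k₁, …, k_r) ↦ (k₁, …, k_r, a)`. -/
def append (a : ℕ+) : FormalSum →ₗ[ℚ] FormalSum := Finsupp.lmapDomain ℚ ℚ (fun k => k ++ [a])

/-- The product of two indices in which a collision of two entries is weighted by `c`:
`∅ · l = l`, `k · ∅ = k` and
`(a, k) · (b, l) = (a, k · (b, l)) + (b, (a, k) · l) + c (a + b, k · l)`. -/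
def quasiShuffle (c : ℚ) : Index → Index → FormalSum
  | [], l => Finsupp.single l 1
  | a :: k, [] => Finsupp.single (a :: k) 1
  | a :: k, b :: l =>
      prepend a (quasiShuffle c k (b :: l)) + prepend b (quasiShuffle c (a :: k) l)
        + c • prepend (a + b) (quasiShuffle c k l)
termination_by k l => k.length + l.length

/-- The stuffle (harmonic) product `k * l`, the product rule of the truncated `ζ`. -/
def stuffle (k l : Index) : FormalSum := quasiShuffle 1 k l

/-- The stuffle product `k *̄ l` for zeta-star values, the product rule of the truncated `ζ^⋆`:
it is the stuffle product with a sign `-1` for each collision. -/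
def barStuffle (k l : Index) : FormalSum := quasiShuffle (-1) k l

/-- For non-empty indices, `k ⊛ l = ((k₁, …, k_{r-1}) * (l₁, …, l_{s-1}), k_r + l_s)`.
(The value `0` when `k` or `l` is empty is a dummy.) -/
def circledastIndex (k l : Index) : FormalSum :=
  if h : k ≠ [] ∧ l ≠ [] then
    append (k.getLast h.1 + l.getLast h.2) (stuffle k.dropLast l.dropLast)
  else 0

/-- `k ⊛ A` for an index `k` and a formal sum `A`, by linearity in `A`. -/
def circledast (k : Index) : FormalSum →ₗ[ℚ] FormalSum :=
  Finsupp.linearCombination ℚ (circledastIndex k)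

/-! ### The star operation -/

/-- The formal sum of all `(a □ l₁ □ ⋯ □ l_s)`, each `□` being a comma or a plus. -/
def starCons : ℕ+ → Index → FormalSum
  | a, [] => Finsupp.single [a] 1
  | a, b :: l => prepend a (starCons b l) + starCons (a + b) l

/-- `l^⋆`, the formal sum of the `2 ^ (s - 1)` indices `(l₁ □ ⋯ □ l_s)` with each `□` a comma or
a plus; `∅^⋆ = ∅`. -/
def starIndex : Index → FormalSum
  | [] => Finsupp.single [] 1
  | a :: l => starCons a l

/-- `A^⋆` for a formal sum `A`, by linearity. -/
def star : FormalSum →ₗ[ℚ] FormalSum := Finsupp.linearCombination ℚ starIndex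

/-! ### The Hoffman dual -/

/-- Writing each entry of a non-empty index `k` as `1 + ⋯ + 1` turns `k` into `(1 □ 1 □ ⋯ □ 1)`.
This is the list of the separators `□`, where `true` is a comma and `false` is a plus. -/
def separators : Index → List Bool
  | [] => []
  | [a] => List.replicate ((a : ℕ) - 1) false
  | a :: b :: l => List.replicate ((a : ℕ) - 1) false ++ true :: separators (b :: l)

/-- Add one to the first entry. -/
def succHead : Index → Index
  | [] => []
  | a :: l => (a + 1) :: l

/-- The index `(1 □ 1 □ ⋯ □ 1)` with the given separators. -/
def ofSeparators : List Bool → Index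
  | [] => [1]
  | true :: w => 1 :: ofSeparators w
  | false :: w => succHead (ofSeparators w)

/-- The Hoffman dual `k^∨`: write each entry of `k` as `1 + ⋯ + 1`, and interchange commas and
pluses; `∅^∨ = ∅`. -/
def hoffmanDualIndex : Index → Index
  | [] => []
  | a :: l => ofSeparators ((separators (a :: l)).map not)

/-- `A^∨` for a formal sum `A`, by linearity. -/
def hoffmanDual : FormalSum →ₗ[ℚ] FormalSum := Finsupp.lmapDomain ℚ ℚ hoffmanDualIndex

/-- An index as a formal sum. -/
def toSum (k : Index) : FormalSum := Finsupp.single k 1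

end

end MZV

/-! The relation is a comparison of Taylor coefficients at `0` in a product formula for Kawashima
functions. To an index `k` belongs a positive array `B i j`, formally the moments `∫ u ^ j (1 - u) ^
i`. Dividing one axis by its variable averages the other axis (`mul_divArray_axis`). Hence one array
carries on its axis `B i 0` the terms of the star sum of `k` by largest variable, and on `B 0 j`
those of the star sum of the Hoffman dual.

The Newton series `F_k(x) = ∑ (-1) ^ j choose(x, j + 1) B 0 j` interpolates the partial sums of `B i
0`; `kawashima x k N` is `F_k(x + N)`. It satisfies `F_(k,a)(y) - F_(k,a)(y - 1) = y ^ (-a) F_k(y)`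
(`kawashima_succ_sub`), the recursion of truncated star sums. So `F_k F_l` and the function of the
bar-stuffle product differ by a quantity constant in `N`. For `x = 0` it vanishes at `N = 0`. For
`x` in `[0, 1]` it vanishes as `N → ∞`, because `F_k(x + N) - F_k(N)` decays faster than `F_l(N)`
grows. This gives `kawashima_mul`.

Finally, `∏ (1 - x / i)` generates the truncated sums of `(1 ^ p)`, so the coefficient of `x ^ m` in
`F_k` is `(-1) ^ (m + 1) ζ((1 ^ m) ⊛ (k^∨)^⋆)` (`hasSum_kawashima`). -/

namespace MZV

noncomputable section

/-! ### Arrays of differences -/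

/-- The array `(i, j) ↦ ∫ u ^ j (1 - u) ^ i` of the point mass at `1`. -/
def unitArray : ℕ → ℕ → ℝ := fun i _ => if i = 0 then 1 else 0

/-- The array whose `j`-axis is that of `B` divided by `j + 1`. -/
def divArray (B : ℕ → ℕ → ℝ) : ℕ → ℕ → ℝ
  | 0, j => B 0 j / (j + 1)
  | i + 1, j => (B (i + 1) j + (i + 1) * divArray B i j) / (i + j + 2)

/-- The array whose `j`-axis consists of the means of the `j`-axis of `B`. -/
def sumArray (B : ℕ → ℕ → ℝ) : ℕ → ℕ → ℝ := fun i j => divArray (fun i j => B j i) j i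

/-- Nonnegative arrays in which every entry is the sum of its two successors. -/
structure IsDifferenceArray (B : ℕ → ℕ → ℝ) : Prop where
  nonneg : ∀ i j, 0 ≤ B i j
  add : ∀ i j, B (i + 1) j + B i (j + 1) = B i j

theorem IsDifferenceArray.swap {B : ℕ → ℕ → ℝ} (h : IsDifferenceArray B) :
    IsDifferenceArray (fun i j => B j i) :=
  ⟨fun i j => h.nonneg j i, fun i j => by rw [add_comm]; exact h.add j i⟩

theorem isDifferenceArray_unitArray : IsDifferenceArray unitArray := by
  refine ⟨fun i j => ?_, fun i j => ?_⟩
  · unfold unitArray; split_ifs <;> norm_num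
  · simp [unitArray]

theorem divArray_succ_mul (B : ℕ → ℕ → ℝ) (i j : ℕ) :
    ((i : ℝ) + j + 2) * divArray B (i + 1) j = B (i + 1) j + (i + 1) * divArray B i j := by
  rw [divArray]; field_simp

theorem divArray_zero_mul (B : ℕ → ℕ → ℝ) (j : ℕ) :
    ((j : ℝ) + 1) * divArray B 0 j = B 0 j := by
  rw [divArray]; field_simp

/-- For moments, dividing by `j + 1` is multiplicative convolution with Lebesgue measure on `[0,
1]`, which keeps the measure positive. The recursion has positive coefficients, and it propagates
the difference law along `i`. -/
theorem IsDifferenceArray.divArray {B : ℕ → ℕ → ℝ} (h : IsDifferenceArray B) :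
    IsDifferenceArray (divArray B) := by
  refine ⟨fun i j => ?_, fun i j => ?_⟩
  · induction i with
    | zero => rw [MZV.divArray]; exact div_nonneg (h.nonneg _ _) (by positivity)
    | succ i ih =>
      rw [MZV.divArray]
      exact div_nonneg (add_nonneg (h.nonneg _ _) (mul_nonneg (by positivity) ih)) (by positivity)
  · induction i with
    | zero =>
      have h1 := divArray_succ_mul B 0 j
      have h2 := divArray_zero_mul B (j + 1)
      have h3 := divArray_zero_mul B j
      have h4 := h.add 0 j
      push_cast at h1 h2
      have h5 : ((j : ℝ) + 2) ≠ 0 := by positivity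
      apply mul_left_cancel₀ h5
      simp only [zero_add] at *
      linear_combination h1 + h2 + h4 - h3
    | succ i ih =>
      have h1 := divArray_succ_mul B (i + 1) j
      have h2 := divArray_succ_mul B i (j + 1)
      have h3 := divArray_succ_mul B i j
      have h4 := h.add (i + 1) j
      push_cast at h1 h2 h3
      have h5 : ((i : ℝ) + j + 3) ≠ 0 := by positivity
      apply mul_left_cancel₀ h5
      linear_combination h1 + h2 + h4 + (i + 1) * ih - h3

theorem IsDifferenceArray.sumArray {B : ℕ → ℕ → ℝ} (h : IsDifferenceArray B) :
    IsDifferenceArray (sumArray B) := h.swap.divArray.swap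

theorem IsDifferenceArray.succ_left_le {B : ℕ → ℕ → ℝ} (h : IsDifferenceArray B) (i j : ℕ) :
    B (i + 1) j ≤ B i j := by
  linarith [h.add i j, h.nonneg i (j + 1)]

theorem IsDifferenceArray.succ_right_le {B : ℕ → ℕ → ℝ} (h : IsDifferenceArray B) (i j : ℕ) :
    B i (j + 1) ≤ B i j := h.swap.succ_left_le j i

theorem IsDifferenceArray.le_left {B : ℕ → ℕ → ℝ} (h : IsDifferenceArray B) (i j : ℕ) :
    B i j ≤ B i 0 :=
  antitone_nat_of_succ_le (f := fun j => B i j) (h.succ_right_le i) (Nat.zero_le j)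

theorem IsDifferenceArray.le_right {B : ℕ → ℕ → ℝ} (h : IsDifferenceArray B) (i j : ℕ) :
    B i j ≤ B 0 j := h.swap.le_left j i

/-- The source of Hoffman duality: division along the `j`-axis is averaging along the `i`-axis. -/
theorem mul_divArray_axis (B : ℕ → ℕ → ℝ) (i : ℕ) :
    ((i : ℝ) + 1) * divArray B i 0 = ∑ h ∈ Finset.range (i + 1), B h 0 := by
  induction i with
  | zero => simpa using divArray_zero_mul B 0
  | succ i ih =>
    rw [Finset.sum_range_succ, ← ih]
    have := divArray_succ_mul B i 0
    push_cast at this ⊢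
    linear_combination this

/-! ### Decay -/

/-- The weight `(n + 1) ^ (-3/4)`. -/
def weight (n : ℕ) : ℝ := ((n : ℝ) + 1) ^ (-(3 / 4) : ℝ)

theorem weight_pos (n : ℕ) : 0 < weight n := Real.rpow_pos_of_pos (by positivity) _

theorem weight_le_one (n : ℕ) : weight n ≤ 1 :=
  Real.rpow_le_one_of_one_le_of_nonpos (by simp) (by norm_num)

theorem inv_le_weight (n : ℕ) : 1 / ((n : ℝ) + 1) ≤ weight n := by
  rw [weight, one_div, ← Real.rpow_neg_one]
  exact Real.rpow_le_rpow_of_exponent_le (by simp) (by norm_num)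

theorem weight_eq (n : ℕ) : weight n = ((n : ℝ) + 1) ^ (1 / 4 : ℝ) / (n + 1) := by
  have h : (0 : ℝ) < n + 1 := by positivity
  rw [weight, show (-(3 / 4) : ℝ) = 1 / 4 - 1 by norm_num, Real.rpow_sub h, Real.rpow_one]

theorem tendsto_weight : Filter.Tendsto weight Filter.atTop (nhds 0) := by
  have h := (tendsto_rpow_neg_atTop (show (0 : ℝ) < 3 / 4 by norm_num)).comp
    (Filter.tendsto_atTop_add_const_right _ (1 : ℝ) tendsto_natCast_atTop_atTop)
  exact h

/-- The exponent `-3/4` absorbs all logarithms: means of the weight are again bounded by a multiple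
of it, and its partial sums grow more slowly than its inverse. -/
theorem sum_weight_le (n : ℕ) :
    ∑ i ∈ Finset.range n, weight i ≤ 4 * (n : ℝ) ^ (1 / 4 : ℝ) := by
  induction n with
  | zero => simp
  | succ n ih =>
    rw [Finset.sum_range_succ]
    set a : ℝ := ((n : ℝ) + 1) ^ (1 / 4 : ℝ) with ha
    set b : ℝ := (n : ℝ) ^ (1 / 4 : ℝ) with hb
    have ha0 : 0 < a := Real.rpow_pos_of_pos (by positivity) _
    have hb0 : 0 ≤ b := Real.rpow_nonneg (by positivity) _
    have ha4 : a ^ 4 = n + 1 := by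
      rw [ha, ← Real.rpow_natCast, ← Real.rpow_mul (by positivity)]; norm_num
    have hb4 : b ^ 4 = n := by
      rw [hb, ← Real.rpow_natCast, ← Real.rpow_mul (by positivity)]; norm_num
    have hba : b ≤ a := Real.rpow_le_rpow (by positivity) (by linarith) (by norm_num)
    have hw : weight n = 1 / a ^ 3 := by
      rw [weight_eq, ← ha, ← ha4]; field_simp
    have key : 1 / a ^ 3 ≤ 4 * (a - b) := by
      rw [div_le_iff₀ (by positivity)]
      -- `a ^ 4 - b ^ 4 = 1`, factored.
      have h1 : (a - b) * (a ^ 3 + a ^ 2 * b + a * b ^ 2 + b ^ 3) = 1 := by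
        linear_combination ha4 - hb4
      have h2 : a ^ 3 + a ^ 2 * b + a * b ^ 2 + b ^ 3 ≤ 4 * a ^ 3 := by
        have e1 : a ^ 2 * b ≤ a ^ 2 * a := by gcongr
        have e2 : a * b ^ 2 ≤ a * a ^ 2 := by gcongr
        have e3 : b ^ 3 ≤ a ^ 3 := by gcongr
        linarith
      nlinarith [mul_le_mul_of_nonneg_left h2 (sub_nonneg.2 hba)]
    push_cast
    rw [hw]
    linarith

theorem mean_le_weight {f : ℕ → ℝ} {C : ℝ} (hC : 0 ≤ C) (hf : ∀ n, f n ≤ C * weight n) (n : ℕ) :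
    (∑ i ∈ Finset.range (n + 1), f i) / (n + 1) ≤ 4 * C * weight n := by
  rw [weight_eq, ← mul_div_assoc]
  gcongr
  calc ∑ i ∈ Finset.range (n + 1), f i ≤ ∑ i ∈ Finset.range (n + 1), C * weight i :=
        Finset.sum_le_sum fun i _ => hf i
    _ = C * ∑ i ∈ Finset.range (n + 1), weight i := by rw [Finset.mul_sum]
    _ ≤ C * (4 * ((n + 1 : ℕ) : ℝ) ^ (1 / 4 : ℝ)) := by gcongr; exact sum_weight_le _
    _ = _ := by push_cast; ring

/-- Both axes of the array decay like the weight. -/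
def Decays (B : ℕ → ℕ → ℝ) : Prop :=
  ∃ C : ℝ, 0 ≤ C ∧ (∀ i, B i 0 ≤ C * weight i) ∧ ∀ j, B 0 j ≤ C * weight j

theorem divArray_axis (B : ℕ → ℕ → ℝ) (i : ℕ) :
    divArray B i 0 = (∑ h ∈ Finset.range (i + 1), B h 0) / (i + 1) := by
  rw [← mul_divArray_axis]; field_simp

/-- Only boundedness is asked of the `j`-axis, so that the lemma applies to `unitArray`, whose
`j`-axis is constantly `1`. -/
theorem decays_divArray {B : ℕ → ℕ → ℝ} {C : ℝ} (hC : 0 ≤ C)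
    (h1 : ∀ i, B i 0 ≤ C * weight i) (h2 : ∀ j, B 0 j ≤ C) : Decays (divArray B) := by
  refine ⟨4 * C, by positivity, fun i => ?_, fun j => ?_⟩
  · rw [divArray_axis]
    exact mean_le_weight hC h1 i
  · calc divArray B 0 j = B 0 j * (1 / (j + 1)) := by rw [divArray]; ring
      _ ≤ C * weight j := by
        have := inv_le_weight j
        have h3 : (0 : ℝ) ≤ 1 / ((j : ℝ) + 1) := by positivity
        exact (mul_le_mul_of_nonneg_right (h2 j) h3).trans (mul_le_mul_of_nonneg_left this hC)
      _ ≤ _ := by nlinarith [mul_nonneg hC (weight_pos j).le]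

theorem Decays.divArray {B : ℕ → ℕ → ℝ} (h : Decays B) : Decays (divArray B) := by
  obtain ⟨C, hC, h1, h2⟩ := h
  exact decays_divArray hC h1 fun j =>
    (h2 j).trans (mul_le_of_le_one_right hC (weight_le_one j))

theorem Decays.swap {B : ℕ → ℕ → ℝ} (h : Decays B) : Decays (fun i j => B j i) := by
  obtain ⟨C, hC, h1, h2⟩ := h
  exact ⟨C, hC, h2, h1⟩

theorem Decays.sumArray {B : ℕ → ℕ → ℝ} (h : Decays B) : Decays (sumArray B) :=
  h.swap.divArray.swap

theorem decays_divArray_unitArray : Decays (divArray unitArray) := by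
  refine decays_divArray zero_le_one (fun i => ?_) (fun j => by simp [unitArray])
  rcases i with - | i
  · simp [unitArray, weight]
  · simpa [unitArray] using (weight_pos (i + 1)).le

/-! ### The array of an index -/

/-- The array of the index with the given reversal. -/
def revArray : List ℕ+ → ℕ → ℕ → ℝ
  | [] => unitArray
  | a :: R => sumArray^[(a : ℕ) - 1] (divArray (revArray R))

/-- The array of an index: its axes are the star sums of the index and of its Hoffman dual. -/
def indexArray (k : Index) : ℕ → ℕ → ℝ := revArray k.reverse

theorem indexArray_nil : indexArray [] = unitArray := rfl

theorem indexArray_append (k : Index) (a : ℕ+) :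
    indexArray (k ++ [a]) = sumArray^[(a : ℕ) - 1] (divArray (indexArray k)) := by
  simp [indexArray, revArray]

theorem isDifferenceArray_indexArray (k : Index) : IsDifferenceArray (indexArray k) := by
  induction k using List.reverseRecOn with
  | nil => exact isDifferenceArray_unitArray
  | append_singleton k a ih =>
    rw [indexArray_append]
    generalize (a : ℕ) - 1 = n
    induction n with
    | zero => exact ih.divArray
    | succ n ihn => rw [Function.iterate_succ_apply']; exact ihn.sumArray

theorem decays_indexArray (k : Index) (hk : k ≠ []) : Decays (indexArray k) := by
  induction k using List.reverseRecOn with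
  | nil => exact absurd rfl hk
  | append_singleton k a ih =>
    rw [indexArray_append]
    generalize (a : ℕ) - 1 = n
    induction n with
    | zero =>
      rcases eq_or_ne k [] with rfl | h
      · exact decays_divArray_unitArray
      · exact (ih h).divArray
    | succ n ihn => rw [Function.iterate_succ_apply']; exact ihn.sumArray

/-! ### Newton coefficients -/

/-- The product `∏_{1 ≤ i ≤ j} (1 + y / i)`. -/
def factorProd (y : ℝ) (j : ℕ) : ℝ := ∏ i ∈ Finset.range j, (1 + y / (i + 1))

/-- The Newton coefficient `(-1) ^ j * choose x (j + 1)`. -/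
def newtonCoeff (x : ℝ) (j : ℕ) : ℝ := x * factorProd (-x) j / (j + 1)

theorem factorProd_zero (y : ℝ) : factorProd y 0 = 1 := by simp [factorProd]

theorem factorProd_succ (y : ℝ) (j : ℕ) :
    factorProd y (j + 1) = factorProd y j * (1 + y / (j + 1)) := by
  simp [factorProd, Finset.prod_range_succ]

theorem factorProd_neg_mem {x : ℝ} (h0 : 0 ≤ x) (h1 : x ≤ 1) (j : ℕ) :
    0 ≤ factorProd (-x) j ∧ factorProd (-x) j ≤ 1 := by
  have h : ∀ i : ℕ, 0 ≤ 1 + -x / ((i : ℝ) + 1) ∧ 1 + -x / ((i : ℝ) + 1) ≤ 1 := by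
    intro i
    have hi : (0 : ℝ) < (i : ℝ) + 1 := by positivity
    have e1 : x / ((i : ℝ) + 1) ≤ 1 := by
      rw [div_le_one hi]; linarith [(Nat.cast_nonneg i : (0 : ℝ) ≤ i)]
    have e2 : 0 ≤ x / ((i : ℝ) + 1) := by positivity
    rw [neg_div]
    constructor <;> linarith
  exact ⟨Finset.prod_nonneg fun i _ => (h i).1,
    Finset.prod_le_one (fun i _ => (h i).1) fun i _ => (h i).2⟩

theorem newtonCoeff_nonneg {x : ℝ} (h0 : 0 ≤ x) (h1 : x ≤ 1) (j : ℕ) : 0 ≤ newtonCoeff x j :=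
  div_nonneg (mul_nonneg h0 (factorProd_neg_mem h0 h1 j).1) (by positivity)

/-- On `[0, 1]` the coefficients are nonnegative with partial sums at most `1`, so a Newton series
is bounded by any nonnegative upper bound of its values. -/
theorem sum_newtonCoeff (x : ℝ) (J : ℕ) :
    ∑ j ∈ Finset.range J, newtonCoeff x j = 1 - factorProd (-x) J := by
  induction J with
  | zero => simp [factorProd_zero]
  | succ J ih => rw [Finset.sum_range_succ, ih, factorProd_succ, newtonCoeff]; ring

theorem sum_newtonCoeff_mul_le {x : ℝ} (h0 : 0 ≤ x) (h1 : x ≤ 1) {g : ℕ → ℝ} {M : ℝ}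
    (hM : 0 ≤ M) (hg : ∀ j, g j ≤ M) (J : ℕ) :
    ∑ j ∈ Finset.range J, newtonCoeff x j * g j ≤ M :=
  calc ∑ j ∈ Finset.range J, newtonCoeff x j * g j
      ≤ ∑ j ∈ Finset.range J, newtonCoeff x j * M :=
        Finset.sum_le_sum fun j _ => mul_le_mul_of_nonneg_left (hg j) (newtonCoeff_nonneg h0 h1 j)
    _ = (1 - factorProd (-x) J) * M := by rw [← Finset.sum_mul, sum_newtonCoeff]
    _ ≤ M := by nlinarith [(factorProd_neg_mem h0 h1 J).1]

theorem summable_newtonCoeff_mul {x : ℝ} (h0 : 0 ≤ x) (h1 : x ≤ 1) {g : ℕ → ℝ} {M : ℝ}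
    (hM : 0 ≤ M) (hg0 : ∀ j, 0 ≤ g j) (hg : ∀ j, g j ≤ M) :
    Summable fun j => newtonCoeff x j * g j :=
  summable_of_sum_range_le (fun j => mul_nonneg (newtonCoeff_nonneg h0 h1 j) (hg0 j))
    (sum_newtonCoeff_mul_le h0 h1 hM hg)

theorem tsum_newtonCoeff_mul_le {x : ℝ} (h0 : 0 ≤ x) (h1 : x ≤ 1) {g : ℕ → ℝ} {M : ℝ}
    (hM : 0 ≤ M) (hg0 : ∀ j, 0 ≤ g j) (hg : ∀ j, g j ≤ M) :
    ∑' j, newtonCoeff x j * g j ≤ M :=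
  Real.tsum_le_of_sum_range_le (fun j => mul_nonneg (newtonCoeff_nonneg h0 h1 j) (hg0 j))
    (sum_newtonCoeff_mul_le h0 h1 hM hg)

/-- Summation by parts: `(j + 2) * newtonCoeff x (j + 1) = (j + 1 - x) * newtonCoeff x j`. -/
theorem sum_newtonCoeff_telescope (x : ℝ) (g : ℕ → ℝ) (J : ℕ) :
    ∑ j ∈ Finset.range J, newtonCoeff x j * ((j + 1) * g j + (x - (j + 1)) * g (j + 1)) =
      x * g 0 - x * factorProd (-x) J * g J := by
  induction J with
  | zero => simp [factorProd_zero]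
  | succ J ih =>
    rw [Finset.sum_range_succ, ih, factorProd_succ, newtonCoeff]
    field_simp
    ring

theorem tendsto_sum_newtonCoeff_telescope {x : ℝ} (h0 : 0 ≤ x) (h1 : x ≤ 1) {g : ℕ → ℝ}
    (hg : Filter.Tendsto g Filter.atTop (nhds 0)) :
    Filter.Tendsto (fun J => ∑ j ∈ Finset.range J,
      newtonCoeff x j * ((j + 1) * g j + (x - (j + 1)) * g (j + 1))) Filter.atTop
        (nhds (x * g 0)) := by
  simp only [sum_newtonCoeff_telescope]
  have h : Filter.Tendsto (fun J => x * factorProd (-x) J * g J) Filter.atTop (nhds 0) := by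
    refine squeeze_zero_norm (a := fun J => x * ‖g J‖) (fun J => ?_)
      (by simpa using hg.norm.const_mul x)
    rw [norm_mul, norm_mul, Real.norm_of_nonneg h0,
      Real.norm_of_nonneg (factorProd_neg_mem h0 h1 J).1]
    gcongr
    exact mul_le_of_le_one_right h0 (factorProd_neg_mem h0 h1 J).2
  simpa using h.const_sub (x * g 0)

/-! ### Interpolated star sums -/

theorem IsDifferenceArray.summable {B : ℕ → ℕ → ℝ} (h : IsDifferenceArray B) {x : ℝ}
    (h0 : 0 ≤ x) (h1 : x ≤ 1) (N : ℕ) : Summable fun j => newtonCoeff x j * B N j :=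
  summable_newtonCoeff_mul h0 h1 (h.nonneg N 0) (h.nonneg N) (h.le_left N)

theorem IsDifferenceArray.summable_succ {B : ℕ → ℕ → ℝ} (h : IsDifferenceArray B) {x : ℝ}
    (h0 : 0 ≤ x) (h1 : x ≤ 1) (N : ℕ) : Summable fun j => newtonCoeff x j * B N (j + 1) :=
  summable_newtonCoeff_mul h0 h1 (h.nonneg N 0) (fun j => h.nonneg N (j + 1))
    (fun j => h.le_left N (j + 1))

theorem Decays.tendsto {B : ℕ → ℕ → ℝ} (hd : Decays B) (h : IsDifferenceArray B) (N : ℕ) :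
    Filter.Tendsto (B N) Filter.atTop (nhds 0) := by
  obtain ⟨C, -, -, h2⟩ := hd
  refine squeeze_zero (h.nonneg N) (fun j => (h.le_right N j).trans (h2 j)) ?_
  simpa using tendsto_weight.const_mul C

/-- The value at `x + N` of the Newton series interpolating the partial sums of `B i 0`. -/
def interpolate (B : ℕ → ℕ → ℝ) (x : ℝ) (N : ℕ) : ℝ :=
  ∑ i ∈ Finset.range N, B i 0 + ∑' j, newtonCoeff x j * B N j

/-- The difference of the interpolated sums at `x + N + 1` and `x + N`. -/
def interpolateDiff (B : ℕ → ℕ → ℝ) (x : ℝ) (N : ℕ) : ℝ :=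
  B N 0 - ∑' j, newtonCoeff x j * B N (j + 1)

theorem interpolate_succ_sub {B : ℕ → ℕ → ℝ} (h : IsDifferenceArray B) {x : ℝ}
    (h0 : 0 ≤ x) (h1 : x ≤ 1) (N : ℕ) :
    interpolate B x (N + 1) - interpolate B x N = interpolateDiff B x N := by
  have e : ∑' j, newtonCoeff x j * B N j =
      ∑' j, newtonCoeff x j * B (N + 1) j + ∑' j, newtonCoeff x j * B N (j + 1) := by
    rw [← (h.summable h0 h1 (N + 1)).tsum_add (h.summable_succ h0 h1 N)]
    congr 1; ext j; rw [← h.add N j]; ring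
  rw [interpolate, interpolate, interpolateDiff, Finset.sum_range_succ, e]
  ring

/-- The recursion of `sumArray` makes the combination of the two series exactly a telescoping sum,
whose limit `x * sumArray B N 0` supplies the missing `x` in the factor. -/
theorem interpolateDiff_sumArray {B : ℕ → ℕ → ℝ} (h : IsDifferenceArray B) (hd : Decays B) {x : ℝ}
    (h0 : 0 ≤ x) (h1 : x ≤ 1) (N : ℕ) :
    (N + 1 + x) * interpolateDiff (sumArray B) x N = interpolateDiff B x N := by
  have hs := h.sumArray
  have hds := hd.sumArray
  have a1 := (hs.summable_succ h0 h1 N).hasSum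
  have a2 := (h.summable_succ h0 h1 N).hasSum
  have a3 := ((a1.mul_left ((N : ℝ) + 1 + x)).sub a2).tendsto_sum_nat
  have a4 := tendsto_sum_newtonCoeff_telescope h0 h1 (hds.tendsto hs N)
  have e : ∀ j : ℕ, ((N : ℝ) + 1 + x) * (newtonCoeff x j * sumArray B N (j + 1)) -
      newtonCoeff x j * B N (j + 1) = newtonCoeff x j *
        ((j + 1) * sumArray B N j + (x - (j + 1)) * sumArray B N (j + 1)) := by
    intro j
    have := divArray_succ_mul (fun i j => B j i) j N
    simp only [sumArray]
    linear_combination newtonCoeff x j * this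
  simp only [e] at a3
  have a5 := tendsto_nhds_unique a3 a4
  have a6 := divArray_zero_mul (fun i j => B j i) N
  rw [interpolateDiff, interpolateDiff]
  change _ * sumArray B N 0 = _ at a6
  linear_combination a6 - a5

/-- Same telescoping; here the difference law first trades `divArray B (N + 1) j` for entries of row
`N`, and the finite part comes from `mul_divArray_axis`. -/
theorem interpolateDiff_divArray {B : ℕ → ℕ → ℝ} (h : IsDifferenceArray B)
    (hd : Decays (divArray B)) {x : ℝ} (h0 : 0 ≤ x) (h1 : x ≤ 1) (N : ℕ) :
    (N + 1 + x) * interpolateDiff (divArray B) x N = interpolate B x (N + 1) := by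
  have hs := h.divArray
  have a1 := (hs.summable_succ h0 h1 N).hasSum
  have a2 := (h.summable h0 h1 (N + 1)).hasSum
  have a3 := ((a1.mul_left ((N : ℝ) + 1 + x)).add a2).tendsto_sum_nat
  have a4 := tendsto_sum_newtonCoeff_telescope h0 h1 (hd.tendsto hs N)
  have e : ∀ j : ℕ, ((N : ℝ) + 1 + x) * (newtonCoeff x j * divArray B N (j + 1)) +
      newtonCoeff x j * B (N + 1) j = newtonCoeff x j *
        ((j + 1) * divArray B N j + (x - (j + 1)) * divArray B N (j + 1)) := by
    intro j
    have e1 := divArray_succ_mul B N j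
    have e2 := hs.add N j
    linear_combination newtonCoeff x j * (-e1 + (N + j + 2) * e2)
  simp only [e] at a3
  have a5 := tendsto_nhds_unique a3 a4
  have a6 := mul_divArray_axis B N
  rw [interpolateDiff, interpolate]
  linear_combination a6 - a5

theorem interpolate_unitArray_succ (x : ℝ) (N : ℕ) : interpolate unitArray x (N + 1) = 1 := by
  simp [interpolate, unitArray]

/-- The Kawashima function of an index at `x + N`. -/
def kawashima (x : ℝ) (k : Index) (N : ℕ) : ℝ :=
  if k = [] then 1 else interpolate (indexArray k) x N

theorem kawashima_nil (x : ℝ) (N : ℕ) : kawashima x [] N = 1 := if_pos rfl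

theorem kawashima_of_ne (x : ℝ) {k : Index} (hk : k ≠ []) (N : ℕ) :
    kawashima x k N = interpolate (indexArray k) x N := if_neg hk

theorem kawashima_succ (x : ℝ) (k : Index) (N : ℕ) :
    kawashima x k (N + 1) = interpolate (indexArray k) x (N + 1) := by
  rcases eq_or_ne k [] with rfl | hk
  · rw [kawashima_nil, indexArray_nil, interpolate_unitArray_succ]
  · exact kawashima_of_ne x hk _

theorem kawashima_succ_sub {x : ℝ} (h0 : 0 ≤ x) (h1 : x ≤ 1) (k : Index) (a : ℕ+) (N : ℕ) :
    kawashima x (k ++ [a]) (N + 1) - kawashima x (k ++ [a]) N =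
      (1 / ((N : ℝ) + 1 + x)) ^ (a : ℕ) * kawashima x k (N + 1) := by
  have hy : (0 : ℝ) < (N : ℝ) + 1 + x := by positivity
  have hne : k ++ [a] ≠ [] := by simp
  rw [kawashima_of_ne x hne, kawashima_of_ne x hne,
    interpolate_succ_sub (isDifferenceArray_indexArray _) h0 h1, kawashima_succ, indexArray_append]
  have hB := isDifferenceArray_indexArray k
  -- `divArray (indexArray k)` is the array of `(k, 1)`, which is non-empty even when `k` is empty.
  have hdiv : Decays (divArray (indexArray k)) := by
    have := decays_indexArray (k ++ [1]) (by simp)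
    rwa [indexArray_append] at this
  obtain ⟨n, hn⟩ : ∃ n, (a : ℕ) = n + 1 := ⟨(a : ℕ) - 1, (Nat.succ_pred_eq_of_pos a.pos).symm⟩
  rw [hn, Nat.add_sub_cancel]
  have key : IsDifferenceArray (sumArray^[n] (divArray (indexArray k))) ∧
      Decays (sumArray^[n] (divArray (indexArray k))) ∧
      ((N : ℝ) + 1 + x) ^ (n + 1) * interpolateDiff (sumArray^[n] (divArray (indexArray k))) x N =
        interpolate (indexArray k) x (N + 1) := by
    clear hn
    induction n with
    | zero => exact ⟨hB.divArray, hdiv, by simpa using interpolateDiff_divArray hB hdiv h0 h1 N⟩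
    | succ n ih =>
      obtain ⟨i1, i2, i3⟩ := ih
      rw [Function.iterate_succ_apply']
      refine ⟨i1.sumArray, i2.sumArray, ?_⟩
      rw [pow_succ, mul_assoc, interpolateDiff_sumArray i1 i2 h0 h1, i3]
  rw [← key.2.2, one_div, inv_pow, inv_mul_cancel_left₀ (by positivity)]

/-! ### Asymptotics -/

theorem newtonCoeff_zero (j : ℕ) : newtonCoeff 0 j = 0 := by simp [newtonCoeff]

theorem kawashima_zero_zero {k : Index} (hk : k ≠ []) : kawashima 0 k 0 = 0 := by
  simp [kawashima_of_ne _ hk, interpolate, newtonCoeff_zero]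

/-- The difference is a Newton series in row `N`, hence at most `indexArray k N 0`; the value at `x
= 0` is a partial sum of the `i`-axis. -/
theorem kawashima_bounds {x : ℝ} (h0 : 0 ≤ x) (h1 : x ≤ 1) {k : Index} (hk : k ≠ []) :
    ∃ C : ℝ, 0 ≤ C ∧ ∀ N, 0 ≤ kawashima x k N - kawashima 0 k N ∧
      kawashima x k N - kawashima 0 k N ≤ C * weight N ∧
      0 ≤ kawashima 0 k N ∧ kawashima 0 k N ≤ C * (N : ℝ) ^ (1 / 4 : ℝ) := by
  have hB := isDifferenceArray_indexArray k
  obtain ⟨C, hC, hC1, -⟩ := decays_indexArray k hk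
  refine ⟨4 * C, by positivity, fun N => ?_⟩
  have e : kawashima x k N - kawashima 0 k N = ∑' j, newtonCoeff x j * indexArray k N j := by
    simp [kawashima_of_ne _ hk, interpolate, newtonCoeff_zero]
  have e0 : kawashima 0 k N = ∑ i ∈ Finset.range N, indexArray k i 0 := by
    simp [kawashima_of_ne _ hk, interpolate, newtonCoeff_zero]
  rw [e, e0]
  refine ⟨tsum_nonneg fun j => mul_nonneg (newtonCoeff_nonneg h0 h1 j) (hB.nonneg N j), ?_,
    Finset.sum_nonneg fun i _ => hB.nonneg i 0, ?_⟩
  · refine ((tsum_newtonCoeff_mul_le h0 h1 (hB.nonneg N 0) (hB.nonneg N) (hB.le_left N)).trans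
      (hC1 N)).trans ?_
    nlinarith [mul_nonneg hC (weight_pos N).le]
  · calc _ ≤ ∑ i ∈ Finset.range N, C * weight i := Finset.sum_le_sum fun i _ => hC1 i
      _ = C * ∑ i ∈ Finset.range N, weight i := by rw [Finset.mul_sum]
      _ ≤ C * (4 * (N : ℝ) ^ (1 / 4 : ℝ)) := by gcongr; exact sum_weight_le _
      _ = _ := by ring

theorem tendsto_weight_mul_rpow :
    Filter.Tendsto (fun N : ℕ => weight N * (N : ℝ) ^ (1 / 4 : ℝ)) Filter.atTop (nhds 0) := by
  have h := ((tendsto_rpow_neg_atTop (show (0 : ℝ) < 1 / 2 by norm_num)).comp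
    (Filter.tendsto_atTop_add_const_right _ (1 : ℝ) tendsto_natCast_atTop_atTop))
  refine squeeze_zero (fun N => mul_nonneg (weight_pos N).le (by positivity)) (fun N => ?_) h
  simp only [Function.comp]
  have hN : (0 : ℝ) < (N : ℝ) + 1 := by positivity
  calc weight N * (N : ℝ) ^ (1 / 4 : ℝ) ≤ weight N * ((N : ℝ) + 1) ^ (1 / 4 : ℝ) := by
        gcongr
        · exact (weight_pos N).le
        · linarith
    _ = ((N : ℝ) + 1) ^ (-(1 / 2) : ℝ) := by
        rw [weight, ← Real.rpow_add hN]; norm_num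

theorem tendsto_kawashima_sub {x : ℝ} (h0 : 0 ≤ x) (h1 : x ≤ 1) {k : Index} (hk : k ≠ []) :
    Filter.Tendsto (fun N => kawashima x k N - kawashima 0 k N) Filter.atTop (nhds 0) := by
  obtain ⟨C, -, h⟩ := kawashima_bounds h0 h1 hk
  exact squeeze_zero (fun N => (h N).1) (fun N => (h N).2.1)
    (by simpa using tendsto_weight.const_mul C)

theorem tendsto_kawashima_sub_mul {x : ℝ} (h0 : 0 ≤ x) (h1 : x ≤ 1) {k l : Index} (hk : k ≠ [])
    (hl : l ≠ []) :
    Filter.Tendsto (fun N => (kawashima x k N - kawashima 0 k N) * kawashima 0 l N)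
      Filter.atTop (nhds 0) := by
  obtain ⟨C, hC, h⟩ := kawashima_bounds h0 h1 hk
  obtain ⟨C', hC', h'⟩ := kawashima_bounds h0 h1 hl
  refine squeeze_zero (fun N => mul_nonneg (h N).1 (h' N).2.2.1) (fun N => ?_)
    (by simpa only [mul_zero] using tendsto_weight_mul_rpow.const_mul (C * C'))
  calc _ ≤ (C * weight N) * (C' * (N : ℝ) ^ (1 / 4 : ℝ)) :=
        mul_le_mul (h N).2.1 (h' N).2.2.2 (h' N).2.2.1 (mul_nonneg hC (weight_pos N).le)
    _ = C * C' * (weight N * (N : ℝ) ^ (1 / 4 : ℝ)) := mul_mul_mul_comm _ _ _ _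

/-! ### The quasi-shuffle product from the last entries -/

theorem prepend_single (a : ℕ+) (k : Index) (q : ℚ) :
    prepend a (Finsupp.single k q) = Finsupp.single (a :: k) q := by
  simp [prepend, Finsupp.lmapDomain_apply, Finsupp.mapDomain_single]

theorem append_single (a : ℕ+) (k : Index) (q : ℚ) :
    append a (Finsupp.single k q) = Finsupp.single (k ++ [a]) q := by
  simp [append, Finsupp.lmapDomain_apply, Finsupp.mapDomain_single]

theorem prepend_append (a b : ℕ+) (X : FormalSum) :
    prepend a (append b X) = append b (prepend a X) := by
  induction X using Finsupp.induction_linear with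
  | zero => simp
  | add X Y hX hY => simp only [map_add, hX, hY]
  | single k q => simp [prepend_single, append_single]

theorem quasiShuffle_nil_left (c : ℚ) (l : Index) :
    quasiShuffle c [] l = Finsupp.single l 1 := by rw [quasiShuffle]

theorem quasiShuffle_nil_right (c : ℚ) (k : Index) :
    quasiShuffle c k [] = Finsupp.single k 1 := by
  cases k <;> rw [quasiShuffle]

theorem quasiShuffle_cons (c : ℚ) (a b : ℕ+) (k l : Index) :
    quasiShuffle c (a :: k) (b :: l) = prepend a (quasiShuffle c k (b :: l)) +
      prepend b (quasiShuffle c (a :: k) l) + c • prepend (a + b) (quasiShuffle c k l) := by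
  rw [quasiShuffle]

/-- The product is defined by first entries, whereas the sums recurse on the largest variable, that
is, on last entries. -/
theorem quasiShuffle_append (c : ℚ) (a b : ℕ+) (k l : Index) :
    quasiShuffle c (k ++ [a]) (l ++ [b]) = append a (quasiShuffle c k (l ++ [b])) +
      append b (quasiShuffle c (k ++ [a]) l) + c • append (a + b) (quasiShuffle c k l) := by
  match k, l with
  | [], [] =>
    simp only [List.nil_append, quasiShuffle_cons, quasiShuffle_nil_left, quasiShuffle_nil_right,
      prepend_single, append_single, List.singleton_append]
    abel
  | [], y :: l =>
    have ih := quasiShuffle_append c a b [] l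
    simp only [List.nil_append, List.cons_append, quasiShuffle_cons, quasiShuffle_nil_left,
      prepend_single, append_single, map_add, map_smul] at ih ⊢
    rw [ih]
    simp only [map_add, map_smul, prepend_single, prepend_append]
    abel
  | x :: k, [] =>
    have ih := quasiShuffle_append c a b k []
    simp only [List.nil_append, List.cons_append, quasiShuffle_cons, quasiShuffle_nil_right,
      prepend_single, append_single, map_add, map_smul] at ih ⊢
    rw [ih]
    simp only [map_add, map_smul, prepend_single, prepend_append]
    abel
  | x :: k, y :: l =>
    have ih1 := quasiShuffle_append c a b k (y :: l)
    have ih2 := quasiShuffle_append c a b (x :: k) l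
    have ih3 := quasiShuffle_append c a b k l
    simp only [List.cons_append] at ih1 ih2 ⊢
    rw [quasiShuffle_cons c x y (k ++ [a]), ih1, ih2, ih3, quasiShuffle_cons c x y k (l ++ [b]),
      quasiShuffle_cons c x y (k ++ [a]) l, quasiShuffle_cons c x y k l]
    simp only [map_add, map_smul, prepend_append, smul_add, smul_smul, mul_comm c]
    abel
termination_by k.length + l.length

theorem quasiShuffle_apply_nil (c : ℚ) {k l : Index} (hk : k ≠ []) (hl : l ≠ []) :
    quasiShuffle c k l [] = 0 := by
  have h : ∀ (a : ℕ+) (X : FormalSum), prepend a X [] = 0 := fun a X =>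
    Finsupp.mapDomain_of_notMem_range (x := X) [] (by simp)
  obtain ⟨a, k, rfl⟩ := List.exists_cons_of_ne_nil hk
  obtain ⟨b, l, rfl⟩ := List.exists_cons_of_ne_nil hl
  rw [quasiShuffle_cons]
  simp [h]

/-! ### Products of iterated sums -/

/-- Linear extension of a real-valued function of indices. -/
def extend (f : Index → ℝ) : FormalSum →ₗ[ℚ] ℝ := Finsupp.linearCombination ℚ f

theorem extend_single (f : Index → ℝ) (k : Index) (q : ℚ) :
    extend f (Finsupp.single k q) = q * f k := by
  simp [extend, Finsupp.linearCombination_single, Rat.smul_def]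

theorem extend_sum (f : Index → ℝ) (X : FormalSum) :
    extend f X = ∑ k ∈ X.support, (X k : ℝ) * f k := by
  simp [extend, Finsupp.linearCombination_apply, Finsupp.sum, Rat.smul_def]

theorem extend_append {f g h : Index → ℝ} {a : ℕ+} {t : ℝ}
    (hf : ∀ k, f (k ++ [a]) = g (k ++ [a]) + t * h k) (X : FormalSum) :
    extend f (append a X) = extend g (append a X) + t * extend h X := by
  induction X using Finsupp.induction_linear with
  | zero => simp
  | add X Y hX hY => simp only [map_add, hX, hY]; ring
  | single k q => simp only [append_single, extend_single, hf]; ring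

theorem quasiShuffle_induction {p : Index → Index → Prop} (hnil_left : ∀ l, p [] l)
    (hnil_right : ∀ k, p k [])
    (happend : ∀ k l a b, p k (l ++ [b]) → p (k ++ [a]) l → p k l → p (k ++ [a]) (l ++ [b]))
    (k l : Index) : p k l := by
  induction k using List.reverseRecOn generalizing l with
  | nil => exact hnil_left l
  | append_singleton k a ihk =>
    induction l using List.reverseRecOn with
    | nil => exact hnil_right _
    | append_singleton l b ihl => exact happend k l a b (ihk _) ihl (ihk _)

/-- Discrete Leibniz rule `Δ(fg) = Δf g + f Δg + Δf Δg` with values at `N`: strict sums give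
collisions a plus sign. -/
theorem extend_stuffle {f : Index → ℕ → ℝ} {u : ℕ → ℝ} (hnil : ∀ N, f [] N = 1)
    (hzero : ∀ k a, f (k ++ [a]) 0 = 0)
    (hsucc : ∀ k (a : ℕ+) N, f (k ++ [a]) (N + 1) = f (k ++ [a]) N + u N ^ (a : ℕ) * f k N)
    (k l : Index) (N : ℕ) : extend (f · N) (stuffle k l) = f k N * f l N := by
  revert N
  refine quasiShuffle_induction (p := fun k l => ∀ N, extend (f · N) (stuffle k l) = f k N * f l N)
    (fun l N => ?_) (fun k N => ?_) (fun k l a b h1 h2 h3 N => ?_) k l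
  · rw [stuffle, quasiShuffle_nil_left, extend_single, hnil]; simp
  · rw [stuffle, quasiShuffle_nil_right, extend_single, hnil]; simp
  · induction N with
    | zero =>
      have h : ∀ a X, extend (f · 0) (append a X) = 0 := fun a X => by
        rw [extend_append (g := fun _ => 0) (h := fun _ => 0) (t := 0) (fun k => by simp [hzero])]
        simp [extend_sum]
      rw [stuffle, quasiShuffle_append]
      simp [h, hzero]
    | succ N ih =>
      have h : ∀ a X, extend (f · (N + 1)) (append a X) =
          extend (f · N) (append a X) + u N ^ (a : ℕ) * extend (f · N) X :=
        fun a => extend_append fun k => hsucc k a N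
      have i1 := h1 N
      have i2 := h2 N
      have i3 := h3 N
      rw [stuffle] at ih i1 i2 i3 ⊢
      rw [quasiShuffle_append] at ih ⊢
      simp only [map_add, one_smul] at ih ⊢
      rw [h, h, h, hsucc, hsucc, i1, i2, i3, PNat.add_coe, pow_add]
      linear_combination ih

/-- With values at `N + 1` the Leibniz rule is `Δ(fg) = Δf g + f Δg - Δf Δg`, whence the minus sign.
It only shows that the defect is constant in `N`; `hconst` isolates the argument that kills the
constant, which differs for `x = 0` and general `x`. -/
theorem extend_barStuffle {f : Index → ℕ → ℝ} {u : ℕ → ℝ} (hnil : ∀ N, f [] N = 1)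
    (hsucc : ∀ k (a : ℕ+) N,
      f (k ++ [a]) (N + 1) - f (k ++ [a]) N = u N ^ (a : ℕ) * f k (N + 1))
    (hconst : ∀ k l : Index, k ≠ [] → l ≠ [] →
      (∀ N, f k N * f l N - extend (f · N) (barStuffle k l) =
        f k 0 * f l 0 - extend (f · 0) (barStuffle k l)) →
      f k 0 * f l 0 - extend (f · 0) (barStuffle k l) = 0)
    (k l : Index) (N : ℕ) : extend (f · N) (barStuffle k l) = f k N * f l N := by
  revert N
  refine quasiShuffle_induction
    (p := fun k l => ∀ N, extend (f · N) (barStuffle k l) = f k N * f l N)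
    (fun l N => ?_) (fun k N => ?_) (fun k l a b h1 h2 h3 => ?_) k l
  · rw [barStuffle, quasiShuffle_nil_left, extend_single, hnil]; simp
  · rw [barStuffle, quasiShuffle_nil_right, extend_single, hnil]; simp
  · have hc : ∀ N, f (k ++ [a]) N * f (l ++ [b]) N -
        extend (f · N) (barStuffle (k ++ [a]) (l ++ [b])) =
        f (k ++ [a]) 0 * f (l ++ [b]) 0 - extend (f · 0) (barStuffle (k ++ [a]) (l ++ [b])) := by
      intro N
      induction N with
      | zero => rfl
      | succ N ih =>
        rw [← ih]
        have h : ∀ a X, extend (f · (N + 1)) (append a X) =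
            extend (f · N) (append a X) + u N ^ (a : ℕ) * extend (f · (N + 1)) X :=
          fun a => extend_append fun k => by rw [← hsucc]; ring
        have i1 := h1 (N + 1)
        have i2 := h2 (N + 1)
        have i3 := h3 (N + 1)
        have j1 := hsucc k a N
        have j2 := hsucc l b N
        rw [barStuffle] at i1 i2 i3 ⊢
        rw [quasiShuffle_append]
        simp only [map_add, neg_smul, one_smul, map_neg]
        rw [h, h, h, i1, i2, i3, PNat.add_coe, pow_add]
        have e1 : f (k ++ [a]) N = f (k ++ [a]) (N + 1) - u N ^ (a : ℕ) * f k (N + 1) := by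
          linarith
        have e2 : f (l ++ [b]) N = f (l ++ [b]) (N + 1) - u N ^ (b : ℕ) * f l (N + 1) := by
          linarith
        rw [e1, e2]
        ring
    intro N
    linarith [hc N, hconst _ _ (by simp) (by simp) hc]

/-! ### The product of Kawashima functions -/

theorem kawashima_zero_mul (k l : Index) (N : ℕ) :
    extend (kawashima 0 · N) (barStuffle k l) = kawashima 0 k N * kawashima 0 l N := by
  refine extend_barStuffle (kawashima_nil 0)
    (fun k a N => kawashima_succ_sub le_rfl zero_le_one k a N) (fun k l hk hl _ => ?_) k l N
  rw [kawashima_zero_zero hk, extend_sum, Finset.sum_eq_zero, zero_mul, sub_zero]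
  intro j hj
  have hj' : j ≠ [] := by
    rintro rfl
    exact Finsupp.mem_support_iff.1 hj (quasiShuffle_apply_nil _ hk hl)
  rw [kawashima_zero_zero hj', mul_zero]

theorem kawashima_mul {x : ℝ} (h0 : 0 ≤ x) (h1 : x ≤ 1) (k l : Index) (N : ℕ) :
    extend (kawashima x · N) (barStuffle k l) = kawashima x k N * kawashima x l N := by
  refine extend_barStuffle (kawashima_nil x)
    (fun k a N => kawashima_succ_sub h0 h1 k a N) (fun k l hk hl hc => ?_) k l N
  have hlim : Filter.Tendsto (fun N => kawashima x k N * kawashima x l N -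
      extend (kawashima x · N) (barStuffle k l)) Filter.atTop (nhds 0) := by
    have t1 := tendsto_kawashima_sub_mul h0 h1 hk hl
    have t2 := tendsto_kawashima_sub_mul h0 h1 hl hk
    have t3 := (tendsto_kawashima_sub h0 h1 hk).mul (tendsto_kawashima_sub h0 h1 hl)
    have t4 : Filter.Tendsto (fun N => extend (kawashima x · N) (barStuffle k l) -
        extend (kawashima 0 · N) (barStuffle k l)) Filter.atTop (nhds 0) := by
      have : ∀ N, extend (kawashima x · N) (barStuffle k l) -
          extend (kawashima 0 · N) (barStuffle k l) = ∑ j ∈ (barStuffle k l).support,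
            (barStuffle k l j : ℝ) * (kawashima x j N - kawashima 0 j N) := fun N => by
        simp only [extend_sum, mul_sub, Finset.sum_sub_distrib]
      simp only [this]
      rw [← Finset.sum_const_zero (s := (barStuffle k l).support)]
      refine tendsto_finsetSum _ fun j hj => ?_
      have hj' : j ≠ [] := by
        rintro rfl
        exact Finsupp.mem_support_iff.1 hj (quasiShuffle_apply_nil _ hk hl)
      simpa using (tendsto_kawashima_sub h0 h1 hj').const_mul (barStuffle k l j : ℝ)
    -- With `δ` the difference between the values at `x + N` and `N`, the product changes by `δ_k
    -- F_l(N) + δ_l F_k(N) + δ_k δ_l`.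
    have t5 := ((t1.add t2).add t3).sub t4
    simp only [add_zero, mul_zero, sub_zero] at t5
    refine t5.congr fun N => ?_
    rw [kawashima_zero_mul]
    ring
  simp only [hc] at hlim
  exact tendsto_nhds_unique tendsto_const_nhds hlim

/-! ### Truncated multiple zeta sums -/

/-- The truncated sum of the index with the given reversal. -/
def revTruncSum : List ℕ+ → ℕ → ℝ
  | [], _ => 1
  | a :: R, N => ∑ m ∈ Finset.range N, revTruncSum R m / ((m : ℝ) + 1) ^ (a : ℕ)

/-- The sum of `1 / (n₁ ^ k₁ ⋯ n_r ^ k_r)` over `0 < n₁ < ⋯ < n_r ≤ N`. -/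
def truncSum (k : Index) (N : ℕ) : ℝ := revTruncSum k.reverse N

/-- The part of the truncated sum with `n_r = j + 1`. -/
def lastSum (k : Index) (j : ℕ) : ℝ := truncSum k (j + 1) - truncSum k j

theorem truncSum_nil (N : ℕ) : truncSum [] N = 1 := rfl

theorem truncSum_append (k : Index) (a : ℕ+) (N : ℕ) :
    truncSum (k ++ [a]) N = ∑ m ∈ Finset.range N, truncSum k m / ((m : ℝ) + 1) ^ (a : ℕ) := by
  simp [truncSum, revTruncSum]

theorem lastSum_nil (j : ℕ) : lastSum [] j = 0 := by simp [lastSum, truncSum_nil]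

theorem lastSum_append (k : Index) (a : ℕ+) (j : ℕ) :
    lastSum (k ++ [a]) j = truncSum k j / ((j : ℝ) + 1) ^ (a : ℕ) := by
  simp [lastSum, truncSum_append, Finset.sum_range_succ]

theorem truncSum_append_eq_sum (k : Index) (a : ℕ+) (N : ℕ) :
    truncSum (k ++ [a]) N = ∑ j ∈ Finset.range N, lastSum (k ++ [a]) j := by
  simp only [lastSum_append, truncSum_append]

theorem truncSum_nonneg (k : Index) (N : ℕ) : 0 ≤ truncSum k N := by
  induction k using List.reverseRecOn generalizing N with
  | nil => simp [truncSum_nil]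
  | append_singleton k a ih =>
    rw [truncSum_append]
    exact Finset.sum_nonneg fun m _ => div_nonneg (ih m) (by positivity)

theorem lastSum_nonneg (k : Index) (j : ℕ) : 0 ≤ lastSum k j := by
  rcases List.eq_nil_or_concat k with rfl | ⟨k, a, rfl⟩
  · simp [lastSum_nil]
  · rw [List.concat_eq_append, lastSum_append]
    exact div_nonneg (truncSum_nonneg k j) (by positivity)

theorem truncSum_le (k : Index) :
    ∃ C : ℝ, 0 ≤ C ∧ ∀ N : ℕ, truncSum k N ≤ C * ((N : ℝ) + 1) ^ (1 / 4 : ℝ) := by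
  induction k using List.reverseRecOn with
  | nil =>
    refine ⟨1, zero_le_one, fun N => ?_⟩
    rw [truncSum_nil, one_mul]
    exact Real.one_le_rpow (by simp) (by norm_num)
  | append_singleton k a ih =>
    obtain ⟨C, hC, h⟩ := ih
    refine ⟨4 * C, by positivity, fun N => ?_⟩
    rw [truncSum_append]
    calc ∑ m ∈ Finset.range N, truncSum k m / ((m : ℝ) + 1) ^ (a : ℕ)
        ≤ ∑ m ∈ Finset.range N, C * weight m := by
          refine Finset.sum_le_sum fun m _ => ?_
          rw [weight_eq, ← mul_div_assoc]
          refine div_le_div₀ (by positivity) (h m) (by positivity) ?_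
          exact le_self_pow₀ (by simp) a.pos.ne'
      _ = C * ∑ m ∈ Finset.range N, weight m := by rw [Finset.mul_sum]
      _ ≤ C * (4 * ((N : ℝ) + 1) ^ (1 / 4 : ℝ)) := by
          gcongr
          refine (sum_weight_le N).trans ?_
          gcongr
          linarith
      _ = _ := by ring

theorem summable_weight_mul {s : ℝ} (hs : s < -(1 / 4)) :
    Summable fun j : ℕ => weight j * ((j : ℝ) + 1) ^ s := by
  have h := (summable_nat_add_iff 1).2 (Real.summable_nat_rpow (p := -(3 / 4) + s) |>.2 (by linarith))
  refine h.congr fun j => ?_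
  rw [weight, ← Real.rpow_add (by positivity)]
  push_cast
  rfl

theorem summable_lastSum (k : Index) (a : ℕ+) (ha : 2 ≤ (a : ℕ)) :
    Summable (lastSum (k ++ [a])) := by
  obtain ⟨C, hC, h⟩ := truncSum_le k
  refine Summable.of_nonneg_of_le (lastSum_nonneg _) (fun j => ?_)
    ((summable_weight_mul (s := -1) (by norm_num)).mul_left C)
  have hj : (0 : ℝ) < (j : ℝ) + 1 := by positivity
  rw [lastSum_append, weight_eq, Real.rpow_neg_one]
  calc truncSum k j / ((j : ℝ) + 1) ^ (a : ℕ)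
      ≤ C * ((j : ℝ) + 1) ^ (1 / 4 : ℝ) / ((j : ℝ) + 1) ^ 2 :=
        div_le_div₀ (by positivity) (h j) (by positivity) (pow_le_pow_right₀ (by simp) ha)
    _ = _ := by field_simp

/-! ### Multiple zeta values as series over the largest summation variable -/

open scoped ENNReal

/-- The iterated series over `m < n₁ < ⋯ < n_r` of `f n_r / (n₁ ^ k₁ ⋯ n_r ^ k_r)`. -/
def iterSeries (f : ℕ → ℝ≥0∞) : Index → ℕ → ℝ≥0∞
  | [], m => f m
  | a :: k, m => ∑' n : ℕ+, if m < n then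
      ENNReal.ofReal (1 / ((n : ℕ) : ℝ) ^ (a : ℕ)) * iterSeries f k n else 0

/-- Peels off `n₁` by `Fin.cons`; in a strictly increasing tuple the lower bound `m` need only be
checked on `n₁`. Extended nonnegative values make every rearrangement legitimate. -/
theorem iterSeries_eq_tsum (k : Index) (m : ℕ) :
    iterSeries 1 k m = ∑' n : Fin k.length → ℕ+, if StrictMono n ∧ ∀ i, m < n i then
      ENNReal.ofReal (∏ i, 1 / ((n i : ℕ) : ℝ) ^ (k.get i : ℕ)) else 0 := by
  induction k generalizing m with
  | nil =>
    rw [iterSeries, tsum_eq_single (fun i => 1) (fun n hn => absurd (funext fun i => i.elim0) hn),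
      if_pos ⟨fun i => i.elim0, fun i => i.elim0⟩]
    simp
  | cons a k ih =>
    change _ = ∑' n : Fin (k.length + 1) → ℕ+, if StrictMono n ∧ ∀ i, m < n i then
      ENNReal.ofReal (∏ i : Fin (k.length + 1), 1 / ((n i : ℕ) : ℝ) ^ ((a :: k).get i : ℕ)) else 0
    rw [← (Fin.consEquiv fun _ : Fin (k.length + 1) => ℕ+).tsum_eq, ENNReal.tsum_prod', iterSeries]
    refine tsum_congr fun n => ?_
    rw [ih]
    by_cases hmn : m < n
    · rw [if_pos hmn, ← ENNReal.tsum_mul_left]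
      refine tsum_congr fun t => ?_
      have hiff : (StrictMono (Fin.cons n t : Fin (k.length + 1) → ℕ+) ∧
          ∀ i, m < ((Fin.cons n t : Fin (k.length + 1) → ℕ+) i : ℕ)) ↔
          (StrictMono t ∧ ∀ i, (n : ℕ) < t i) := by
        constructor
        · rintro ⟨h1, -⟩
          refine ⟨fun i j hij => ?_, fun i => ?_⟩
          · simpa using h1 (Fin.succ_lt_succ_iff.2 hij)
          · simpa using h1 (Fin.succ_pos i)
        · rintro ⟨h1, h2⟩
          refine ⟨fun i j hij => ?_, fun i => ?_⟩
          · induction i using Fin.cases with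
            | zero =>
              induction j using Fin.cases with
              | zero => exact absurd hij (lt_irrefl _)
              | succ j => simpa using h2 j
            | succ i =>
              induction j using Fin.cases with
              | zero => exact absurd hij (Fin.not_lt_zero _)
              | succ j => simpa using h1 (Fin.succ_lt_succ_iff.1 hij)
          · induction i using Fin.cases with
            | zero => simpa using hmn
            | succ i => simpa using hmn.trans (h2 i)
      change _ = if StrictMono (Fin.cons n t : Fin (k.length + 1) → ℕ+) ∧
          ∀ i, m < ((Fin.cons n t : Fin (k.length + 1) → ℕ+) i : ℕ) then
        ENNReal.ofReal (∏ i : Fin (k.length + 1), 1 /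
          (((Fin.cons n t : Fin (k.length + 1) → ℕ+) i : ℕ) : ℝ) ^ ((a :: k).get i : ℕ)) else 0
      by_cases hc : StrictMono t ∧ ∀ i, (n : ℕ) < t i
      · rw [if_pos hc, if_pos (hiff.2 hc), Fin.prod_univ_succ,
          ENNReal.ofReal_mul (by positivity)]
        simp
      · rw [if_neg hc, if_neg (hiff.not.2 hc), mul_zero]
    · rw [if_neg hmn]
      symm
      rw [ENNReal.tsum_eq_zero]
      intro t
      refine if_neg fun h => hmn ?_
      simpa using h.2 0

theorem iterSeries_zero_eq (k : Index) :
    iterSeries 1 k 0 = ∑' n, ENNReal.ofReal (zetaTerm k n) := by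
  rw [iterSeries_eq_tsum]
  have h := tsum_subtype {n : Fin k.length → ℕ+ | StrictMono n}
    (fun n => ENNReal.ofReal (∏ i, 1 / ((n i : ℕ) : ℝ) ^ (k.get i : ℕ)))
  refine Eq.trans ?_ h.symm
  refine tsum_congr fun n => ?_
  simp [Set.indicator_apply]

theorem iterSeries_append (f : ℕ → ℝ≥0∞) (k : Index) (a : ℕ+) (m : ℕ) :
    iterSeries f (k ++ [a]) m = iterSeries (iterSeries f [a]) k m := by
  induction k generalizing m with
  | nil => rfl
  | cons b k ih => simp only [List.cons_append, iterSeries, ih]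

/-- The free function `f` makes the induction close: removing the last entry replaces `f` by the
inner series `iterSeries f [a]`, and exchanging the two sums rebuilds `truncSum`. -/
theorem iterSeries_append_zero (f : ℕ → ℝ≥0∞) (k : Index) (a : ℕ+) :
    iterSeries f (k ++ [a]) 0 =
      ∑' j : ℕ, ENNReal.ofReal (lastSum (k ++ [a]) j) * f (j + 1) := by
  have hone : ∀ (f : ℕ → ℝ≥0∞) (a : ℕ+) (m : ℕ), iterSeries f [a] m = ∑' n : ℕ, if m ≤ n then
      ENNReal.ofReal (1 / ((n : ℝ) + 1) ^ (a : ℕ)) * f (n + 1) else 0 := by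
    intro f a m
    rw [iterSeries, ← Equiv.pnatEquivNat.symm.tsum_eq]
    refine tsum_congr fun n => ?_
    simp [iterSeries]
  induction k using List.reverseRecOn generalizing f a with
  | nil =>
    rw [List.nil_append, hone]
    refine tsum_congr fun j => ?_
    rw [← List.nil_append [a], lastSum_append, truncSum_nil, if_pos (Nat.zero_le j)]
  | append_singleton k b ih =>
    rw [iterSeries_append, ih]
    simp only [hone, ← ENNReal.tsum_mul_left]
    rw [ENNReal.tsum_comm]
    refine tsum_congr fun n => ?_
    have h1 : ∀ j : ℕ, ENNReal.ofReal (lastSum (k ++ [b]) j) * (if j + 1 ≤ n then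
        ENNReal.ofReal (1 / ((n : ℝ) + 1) ^ (a : ℕ)) * f (n + 1) else 0) =
        (if j ∈ Finset.range n then ENNReal.ofReal (lastSum (k ++ [b]) j) else 0) *
          (ENNReal.ofReal (1 / ((n : ℝ) + 1) ^ (a : ℕ)) * f (n + 1)) := by
      intro j
      simp only [Finset.mem_range, Nat.succ_le_iff]
      split_ifs <;> simp
    simp only [h1, ENNReal.tsum_mul_right]
    rw [tsum_eq_sum (s := Finset.range n) (fun j hj => if_neg hj),
      Finset.sum_congr rfl (fun j hj => if_pos hj),
      ← ENNReal.ofReal_sum_of_nonneg (fun j _ => lastSum_nonneg _ j), ← truncSum_append_eq_sum,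
      ← mul_assoc, ← ENNReal.ofReal_mul (truncSum_nonneg _ _), lastSum_append, mul_one_div]

theorem tsum_ofReal_zetaTerm (k : Index) (a : ℕ+) :
    ∑' n, ENNReal.ofReal (zetaTerm (k ++ [a]) n) =
      ∑' j, ENNReal.ofReal (lastSum (k ++ [a]) j) := by
  rw [← iterSeries_zero_eq, iterSeries_append_zero]
  simp

theorem zetaTerm_nonneg (k : Index) (n : {n : Fin k.length → ℕ+ // StrictMono n}) :
    0 ≤ zetaTerm k n := Finset.prod_nonneg fun _ _ => by positivity

theorem zetaIndex_append (k : Index) (a : ℕ+) :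
    zetaIndex (k ++ [a]) = ∑' j, lastSum (k ++ [a]) j := by
  have h := congrArg ENNReal.toReal (tsum_ofReal_zetaTerm k a)
  rw [ENNReal.tsum_toReal_eq (fun _ => ENNReal.ofReal_ne_top),
    ENNReal.tsum_toReal_eq (fun _ => ENNReal.ofReal_ne_top)] at h
  simp only [ENNReal.toReal_ofReal (zetaTerm_nonneg _ _),
    ENNReal.toReal_ofReal (lastSum_nonneg _ _)] at h
  exact h

theorem summable_zetaTerm (k : Index) (a : ℕ+) (ha : 2 ≤ (a : ℕ)) :
    Summable (zetaTerm (k ++ [a])) := by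
  have h : ∑' n, ENNReal.ofReal (zetaTerm (k ++ [a]) n) ≠ ∞ := by
    rw [tsum_ofReal_zetaTerm, ← ENNReal.ofReal_tsum_of_nonneg (lastSum_nonneg _)
      (summable_lastSum k a ha)]
    exact ENNReal.ofReal_ne_top
  simpa only [ENNReal.toReal_ofReal (zetaTerm_nonneg _ _)] using ENNReal.summable_toReal h

/-! ### The star operation from the last entries -/

theorem starCons_append (x : ℕ+) (l : Index) (a b : ℕ+) :
    starCons x (l ++ [b] ++ [a]) =
      append a (starCons x (l ++ [b])) + starCons x (l ++ [b + a]) := by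
  induction l generalizing x with
  | nil =>
    simp only [List.nil_append, starCons, map_add, prepend_single,
      append_single, List.cons_append, add_assoc]
    abel
  | cons c l ih =>
    simp only [List.cons_append, starCons, map_add, ih, prepend_append]
    abel

/-- Splits according to whether the last box is a comma or a plus. -/
theorem starIndex_append (k : Index) (a b : ℕ+) :
    starIndex (k ++ [b] ++ [a]) =
      append a (starIndex (k ++ [b])) + starIndex (k ++ [b + a]) := by
  cases k with
  | nil =>
    simp only [List.nil_append, List.singleton_append, starIndex, starCons, prepend_single,
      append_single]
  | cons x l => exact starCons_append x l a b

theorem extend_lastSum_append (a : ℕ+) (j : ℕ) (X : FormalSum) :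
    extend (lastSum · j) (append a X) = extend (truncSum · j) X / ((j : ℝ) + 1) ^ (a : ℕ) := by
  have h := extend_append (f := (lastSum · j)) (g := fun _ => 0) (h := (truncSum · j)) (a := a)
    (t := 1 / ((j : ℝ) + 1) ^ (a : ℕ)) (fun k => by rw [lastSum_append]; ring) X
  rw [h, extend_sum (fun _ => 0)]
  simp only [mul_zero, Finset.sum_const_zero]
  ring

theorem extend_lastSum (j : ℕ) (X : FormalSum) :
    extend (lastSum · j) X = extend (truncSum · (j + 1)) X - extend (truncSum · j) X := by
  simp only [extend_sum, lastSum, mul_sub, Finset.sum_sub_distrib]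

theorem extend_lastSum_starIndex_add (k : Index) (a c : ℕ+) (j : ℕ) :
    extend (lastSum · j) (starIndex (k ++ [a + c])) =
      extend (lastSum · j) (starIndex (k ++ [a])) / ((j : ℝ) + 1) ^ (c : ℕ) := by
  induction k using List.reverseRecOn generalizing a with
  | nil =>
    have h : ∀ a : ℕ+, starIndex ([] ++ [a]) = append a (Finsupp.single [] 1) := fun a => by
      simp [starIndex, starCons, append_single]
    rw [h, h, extend_lastSum_append, extend_lastSum_append, PNat.add_coe, pow_add, div_div]
  | append_singleton k b ih =>
    rw [starIndex_append, starIndex_append, map_add, map_add, ← add_assoc, ih,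
      extend_lastSum_append, extend_lastSum_append, PNat.add_coe, pow_add, add_div, div_div]

theorem extend_truncSum_starIndex_zero (k : Index) (a : ℕ+) :
    extend (truncSum · 0) (starIndex (k ++ [a])) = 0 := by
  have h : ∀ a X, extend (truncSum · 0) (append a X) = 0 := fun a X => by
    rw [extend_append (g := fun _ => 0) (h := fun _ => 0) (t := 0)
      (fun k => by simp [truncSum_append])]
    simp [extend_sum]
  induction k using List.reverseRecOn generalizing a with
  | nil =>
    rw [List.nil_append, starIndex, starCons, ← List.nil_append [a], ← append_single, h]
  | append_singleton k b ih => rw [starIndex_append, map_add, h, ih, add_zero]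

theorem extend_truncSum_starIndex (k : Index) (a : ℕ+) (N : ℕ) :
    extend (truncSum · N) (starIndex (k ++ [a])) =
      ∑ j ∈ Finset.range N, extend (lastSum · j) (starIndex (k ++ [a])) := by
  induction N with
  | zero => rw [extend_truncSum_starIndex_zero, Finset.sum_range_zero]
  | succ N ih => rw [Finset.sum_range_succ, ← ih, extend_lastSum]; ring

/-! ### The Hoffman dual -/

/-- The array obtained by applying the operations encoded by a reversed list of separators. -/
def separatorArray : List Bool → ℕ → ℕ → ℝ
  | [] => divArray unitArray
  | true :: w => sumArray (separatorArray w)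
  | false :: w => divArray (separatorArray w)

theorem separatorArray_replicate (n : ℕ) (w : List Bool) :
    separatorArray (List.replicate n true ++ w) = sumArray^[n] (separatorArray w) := by
  induction n with
  | zero => rfl
  | succ n ih => rw [List.replicate_succ, Function.iterate_succ_apply', ← ih]; rfl

theorem separators_append (k : Index) (hk : k ≠ []) (a : ℕ+) :
    separators (k ++ [a]) = separators k ++ true :: List.replicate ((a : ℕ) - 1) false := by
  induction k with
  | nil => exact absurd rfl hk
  | cons b k ih =>
    cases k with
    | nil => simp [separators]
    | cons c k =>
      have := ih (by simp)
      simp only [List.cons_append] at this ⊢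
      simp [separators, this]

/-- After negation, each plus inside an entry of `k` is a `sumArray` step and each comma a
`divArray` step. -/
theorem indexArray_eq_separatorArray (k : Index) (hk : k ≠ []) :
    indexArray k = separatorArray ((separators k).map not).reverse := by
  induction k using List.reverseRecOn with
  | nil => exact absurd rfl hk
  | append_singleton k a ih =>
    rw [indexArray_append]
    rcases eq_or_ne k [] with rfl | h
    · have := separatorArray_replicate ((a : ℕ) - 1) []
      simp only [List.append_nil] at this
      simp [separators, this, separatorArray, indexArray_nil]
    · have := separatorArray_replicate ((a : ℕ) - 1)
        (false :: ((separators k).map not).reverse)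
      rw [ih h, separators_append k h]
      simp only [separatorArray] at this
      rw [← this]
      congr 1
      simp

theorem ofSeparators_append (w : List Bool) : ∃ (k : Index) (a : ℕ+),
    ofSeparators w = k ++ [a] ∧ ofSeparators (w ++ [false]) = k ++ [a + 1] ∧
      ofSeparators (w ++ [true]) = k ++ [a] ++ [1] := by
  induction w with
  | nil => exact ⟨[], 1, rfl, rfl, rfl⟩
  | cons s w ih =>
    obtain ⟨k, a, h1, h2, h3⟩ := ih
    cases s with
    | true => exact ⟨1 :: k, a, by simp [ofSeparators, h1], by simp [ofSeparators, h2],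
        by simp [ofSeparators, h3]⟩
    | false =>
      cases k with
      | nil => exact ⟨[], a + 1, by simp [ofSeparators, h1, succHead],
          by simp [ofSeparators, h2, succHead], by simp [ofSeparators, h3, succHead]⟩
      | cons b k => exact ⟨(b + 1) :: k, a, by simp [ofSeparators, h1, succHead],
          by simp [ofSeparators, h2, succHead], by simp [ofSeparators, h3, succHead]⟩

/-- On the `j`-axis, a plus in the dual divides by `j + 1`, and a comma takes the mean: the comma
and plus choices of the star supply the terms `h < j` and `h = j`. -/
theorem extend_lastSum_starIndex_ofSeparators (w : List Bool) (j : ℕ) :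
    extend (lastSum · j) (starIndex (ofSeparators w.reverse)) = separatorArray w 0 j := by
  induction w generalizing j with
  | nil =>
    have : starIndex (ofSeparators [].reverse) = append 1 (Finsupp.single [] 1) := by
      simp [ofSeparators, starIndex, starCons, append_single]
    rw [this, extend_lastSum_append, extend_single, truncSum_nil]
    simp [separatorArray, divArray, unitArray]
  | cons s w ih =>
    obtain ⟨k, a, h1, h2, h3⟩ := ofSeparators_append w.reverse
    rw [h1] at ih
    rw [List.reverse_cons]
    cases s with
    | false =>
      rw [h2, extend_lastSum_starIndex_add, ih, separatorArray, divArray]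
      simp
    | true =>
      rw [h3, starIndex_append, map_add, extend_lastSum_append, extend_lastSum_starIndex_add,
        extend_truncSum_starIndex, separatorArray, sumArray, divArray_axis,
        Finset.sum_range_succ]
      simp only [ih, PNat.one_coe, pow_one, add_div]

theorem extend_lastSum_starIndex_hoffmanDualIndex (k : Index) (hk : k ≠ []) (j : ℕ) :
    extend (lastSum · j) (starIndex (hoffmanDualIndex k)) = indexArray k 0 j := by
  rw [indexArray_eq_separatorArray k hk, ← extend_lastSum_starIndex_ofSeparators,
    List.reverse_reverse]
  obtain ⟨a, l, rfl⟩ := List.exists_cons_of_ne_nil hk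
  rw [hoffmanDualIndex]

/-! ### The circled product -/

/-- Both largest variables equal `j + 1`, so the last exponents add while the remaining truncated
sums multiply by stuffle. -/
theorem extend_lastSum_circledastIndex (k l : Index) (j : ℕ) :
    extend (lastSum · j) (circledastIndex k l) = lastSum k j * lastSum l j := by
  rcases List.eq_nil_or_concat k with rfl | ⟨k, a, rfl⟩
  · simp [circledastIndex, lastSum_nil]
  rcases List.eq_nil_or_concat l with rfl | ⟨l, b, rfl⟩
  · simp [circledastIndex, lastSum_nil]
  simp only [List.concat_eq_append]
  rw [circledastIndex, dif_pos ⟨by simp, by simp⟩, extend_lastSum_append]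
  simp only [List.getLast_append_singleton, List.dropLast_concat, lastSum_append, PNat.add_coe,
    pow_add]
  rw [extend_stuffle (f := truncSum) (u := fun m => 1 / ((m : ℝ) + 1)) truncSum_nil
    (fun k a => by simp [truncSum_append])
    (fun k a N => by rw [truncSum_append, truncSum_append, Finset.sum_range_succ]; simp; ring)]
  field_simp

theorem extend_lastSum_circledast (k : Index) (A : FormalSum) (j : ℕ) :
    extend (lastSum · j) (circledast k A) = lastSum k j * extend (lastSum · j) A := by
  induction A using Finsupp.induction_linear with
  | zero => simp
  | add X Y hX hY => simp only [map_add, hX, hY]; ring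
  | single l q =>
    rw [circledast, Finsupp.linearCombination_single, map_smul, extend_lastSum_circledastIndex,
      extend_single, Rat.smul_def]
    ring

/-- The indices whose last entry is at least `2`. -/
def admissible : Set Index := {t | ∃ (k : Index) (a : ℕ+), 2 ≤ (a : ℕ) ∧ t = k ++ [a]}

theorem append_mem_supported (a : ℕ+) (ha : 2 ≤ (a : ℕ)) (X : FormalSum) :
    append a X ∈ Finsupp.supported ℚ ℚ admissible := by
  induction X using Finsupp.induction_linear with
  | zero => simp
  | add X Y hX hY => rw [map_add]; exact add_mem hX hY
  | single k q =>
    rw [append_single]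
    exact Finsupp.single_mem_supported ℚ q ⟨k, a, ha, rfl⟩

/-- A sum of two positive last entries is at least `2`, which gives convergence. -/
theorem circledast_mem_supported (k : Index) (A : FormalSum) :
    circledast k A ∈ Finsupp.supported ℚ ℚ admissible := by
  rw [circledast, Finsupp.linearCombination_apply]
  refine Submodule.sum_mem _ fun l _ => Submodule.smul_mem _ _ ?_
  rw [circledastIndex]
  split_ifs with h
  · refine append_mem_supported _ ?_ _
    rw [PNat.add_coe]
    exact Nat.add_le_add (PNat.pos _) (PNat.pos _)
  · exact zero_mem _

theorem converges_circledast (k : Index) (A : FormalSum) : Converges (circledast k A) := by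
  intro t ht
  obtain ⟨t, a, ha, rfl⟩ := (Finsupp.mem_supported ℚ _).1 (circledast_mem_supported k A) ht
  exact summable_zetaTerm t a ha

theorem hasSum_zeta_circledast (k : Index) (A : FormalSum) :
    HasSum (fun j => lastSum k j * extend (lastSum · j) A) (zeta (circledast k A)) := by
  simp only [← extend_lastSum_circledast]
  change HasSum _ (extend zetaIndex (circledast k A))
  simp only [extend_sum]
  refine hasSum_sum fun t ht => ?_
  obtain ⟨t, a, ha, rfl⟩ := (Finsupp.mem_supported ℚ _).1 (circledast_mem_supported k A) ht
  rw [zetaIndex_append]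
  exact (summable_lastSum t a ha).hasSum.mul_left _

/-! ### Taylor coefficients of Kawashima functions -/

theorem ones_succ (p : ℕ) : ones (p + 1) = ones p ++ [1] := List.replicate_succ'

theorem truncSum_ones_succ (p N : ℕ) : truncSum (ones (p + 1)) (N + 1) =
    truncSum (ones (p + 1)) N + truncSum (ones p) N / ((N : ℝ) + 1) := by
  rw [ones_succ, truncSum_append, truncSum_append, Finset.sum_range_succ]
  simp

/-- The truncated sums of `(1 ^ p)` are the elementary symmetric functions of `1, 1/2, …, 1/j`. -/
theorem hasSum_truncSum_ones (y : ℝ) (j : ℕ) :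
    HasSum (fun p => y ^ p * truncSum (ones p) j) (factorProd y j) := by
  induction j with
  | zero =>
    rw [factorProd_zero]
    have h := hasSum_single (f := fun p => y ^ p * truncSum (ones p) 0) 0 fun p hp => by
      obtain ⟨p, rfl⟩ := Nat.exists_eq_succ_of_ne_zero hp
      simp [ones_succ, truncSum_append]
    simpa [ones, truncSum_nil] using h
  | succ j ih =>
    rw [← hasSum_nat_add_iff' 1] at ih ⊢
    have h0 := (hasSum_nat_add_iff' 1).1 ih
    have h := ih.add (h0.mul_left (y / ((j : ℝ) + 1)))
    simp only [Finset.sum_range_one, pow_zero, one_mul, ones, List.replicate_zero,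
      truncSum_nil] at h ⊢
    have e : factorProd y (j + 1) - 1 =
        factorProd y j - 1 + y / ((j : ℝ) + 1) * factorProd y j := by
      rw [factorProd_succ]; ring
    rw [e]
    refine h.congr_fun fun p => ?_
    have := truncSum_ones_succ p j
    simp only [ones] at this
    rw [this, pow_succ]
    ring

theorem factorProd_le {x : ℝ} (h0 : 0 ≤ x) (h1 : x ≤ 1 / 4) (j : ℕ) :
    factorProd x j ≤ ((j : ℝ) + 1) ^ (1 / 2 : ℝ) := by
  have hpos : 0 ≤ factorProd x j := Finset.prod_nonneg fun i _ => by positivity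
  rw [← Real.sqrt_eq_rpow]
  apply Real.le_sqrt_of_sq_le
  induction j with
  | zero => simp [factorProd_zero]
  | succ j ih =>
    have ih := ih (Finset.prod_nonneg fun i _ => by positivity)
    rw [factorProd_succ, mul_pow]
    have hj : (0 : ℝ) < (j : ℝ) + 1 := by positivity
    have h2 : (1 + x / ((j : ℝ) + 1)) ^ 2 ≤ (((j + 1 : ℕ) : ℝ) + 1) / (j + 1) := by
      rw [le_div_iff₀ hj]
      have e : (1 + x / ((j : ℝ) + 1)) ^ 2 * (j + 1) = j + 1 + 2 * x + x * (x / (j + 1)) := by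
        field_simp; ring
      have e2 : x / ((j : ℝ) + 1) ≤ x := div_le_self h0 (by simp)
      rw [e]
      push_cast
      nlinarith
    calc factorProd x j ^ 2 * (1 + x / ((j : ℝ) + 1)) ^ 2
        ≤ ((j : ℝ) + 1) * ((((j + 1 : ℕ) : ℝ) + 1) / (j + 1)) := by gcongr
      _ = _ := by field_simp

/-- The multiple zeta values `ζ((1 ^ m) ⊛ (A^∨)^⋆)`. -/
def zetaDual (m : ℕ) (A : FormalSum) : ℝ := zeta (circledast (ones m) (star (hoffmanDual A)))

theorem zetaDual_zero (A : FormalSum) : zetaDual 0 A = 0 := by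
  have h : ∀ X, circledast (ones 0) X = 0 := fun X => by
    simp [circledast, Finsupp.linearCombination_apply, circledastIndex, ones]
  rw [zetaDual, h, map_zero]

theorem zetaDual_eq_extend (m : ℕ) (A : FormalSum) :
    zetaDual m A = extend (fun k => zetaDual m (toSum k)) A := by
  induction A using Finsupp.induction_linear with
  | zero => simp [zetaDual]
  | add X Y hX hY => rw [map_add, ← hX, ← hY]; simp only [zetaDual, map_add]
  | single k q =>
    have : (Finsupp.single k q : FormalSum) = q • toSum k := by simp [toSum]
    rw [extend_single, this]
    simp only [zetaDual, map_smul, Rat.smul_def]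

theorem hasSum_zetaDual (p : ℕ) {k : Index} (hk : k ≠ []) :
    HasSum (fun j => truncSum (ones p) j / ((j : ℝ) + 1) * indexArray k 0 j)
      (zetaDual (p + 1) (toSum k)) := by
  refine (hasSum_zeta_circledast (ones (p + 1)) (star (hoffmanDual (toSum k)))).congr_fun
    fun j => ?_
  have h : star (hoffmanDual (toSum k)) = starIndex (hoffmanDualIndex k) := by
    simp [star, hoffmanDual, toSum, Finsupp.lmapDomain_apply, Finsupp.mapDomain_single,
      Finsupp.linearCombination_single]
  rw [h, extend_lastSum_starIndex_hoffmanDualIndex k hk, ones_succ, lastSum_append]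
  simp

/-- Absolute convergence for exchanging the sums over `j` and `p`. Taking `x ≤ 1/4` bounds the
product by `(j + 1) ^ (1/2)`, leaving terms of order `(j + 1) ^ (-5/4)`. -/
theorem summable_kawashima_double {x : ℝ} (h0 : 0 ≤ x) (h1 : x ≤ 1 / 4) {k : Index}
    (hk : k ≠ []) : Summable fun jp : ℕ × ℕ => x ^ jp.2 * truncSum (ones jp.2) jp.1 *
      (indexArray k 0 jp.1 / ((jp.1 : ℝ) + 1)) := by
  have hB := isDifferenceArray_indexArray k
  obtain ⟨C, hC, -, h2⟩ := decays_indexArray k hk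
  have hs := fun j : ℕ =>
    (hasSum_truncSum_ones x j).mul_right (indexArray k 0 j / ((j : ℝ) + 1))
  rw [summable_prod_of_nonneg fun jp => mul_nonneg
    (mul_nonneg (pow_nonneg h0 _) (truncSum_nonneg _ _))
    (div_nonneg (hB.nonneg _ _) (by positivity))]
  refine ⟨fun j => (hs j).summable, ?_⟩
  simp only [(hs _).tsum_eq]
  refine Summable.of_nonneg_of_le (fun j => mul_nonneg
    (Finset.prod_nonneg fun i _ => by positivity) (div_nonneg (hB.nonneg _ _) (by positivity)))
    (fun j => ?_) ((summable_weight_mul (s := -(1 / 2)) (by norm_num)).mul_left C)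
  have hj : (0 : ℝ) < (j : ℝ) + 1 := by positivity
  have e : ((j : ℝ) + 1) ^ (-(1 / 2) : ℝ) = ((j : ℝ) + 1) ^ (1 / 2 : ℝ) / (j + 1) := by
    rw [show (-(1 / 2) : ℝ) = 1 / 2 - 1 by norm_num, Real.rpow_sub hj, Real.rpow_one]
  calc factorProd x j * (indexArray k 0 j / ((j : ℝ) + 1))
      ≤ ((j : ℝ) + 1) ^ (1 / 2 : ℝ) * (C * weight j / ((j : ℝ) + 1)) := by
        refine mul_le_mul (factorProd_le h0 h1 j) ?_
          (div_nonneg (hB.nonneg _ _) hj.le) (by positivity)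
        gcongr
        exact h2 j
    _ = _ := by rw [e]; ring

/-- The Taylor coefficients of the Kawashima function of `A` at the origin. -/
def taylorCoeff (A : FormalSum) (m : ℕ) : ℝ := (-1) ^ (m + 1) * zetaDual m A

/-- Expanding each Newton coefficient in powers of `x` and summing over `j` first turns the
coefficients into zeta values. -/
theorem hasSum_kawashima {x : ℝ} (h0 : 0 ≤ x) (h1 : x ≤ 1 / 4) {k : Index} (hk : k ≠ []) :
    HasSum (fun m => taylorCoeff (toSum k) m * x ^ m) (kawashima x k 0) := by
  have hsum : Summable fun jp : ℕ × ℕ => (-x) ^ jp.2 * truncSum (ones jp.2) jp.1 *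
      (indexArray k 0 jp.1 / ((jp.1 : ℝ) + 1)) := by
    refine Summable.of_norm ((summable_kawashima_double h0 h1 hk).congr fun jp => ?_)
    rw [norm_mul, norm_mul, norm_pow, norm_neg, Real.norm_of_nonneg h0,
      Real.norm_of_nonneg (truncSum_nonneg _ _),
      Real.norm_of_nonneg (div_nonneg ((isDifferenceArray_indexArray k).nonneg _ _)
        (by positivity))]
  have e1 := hsum.hasSum.prod_fiberwise fun j =>
    (hasSum_truncSum_ones (-x) j).mul_right (indexArray k 0 j / ((j : ℝ) + 1))
  have e2 := ((Equiv.prodComm ℕ ℕ).hasSum_iff.2 hsum.hasSum).prod_fiberwise fun p =>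
    ((hasSum_zetaDual p hk).mul_left ((-x) ^ p)).congr_fun fun j => by
      simp only [Function.comp, Equiv.prodComm_apply, Prod.swap]; ring
  have e3 : kawashima x k 0 = x * ∑' jp : ℕ × ℕ, (-x) ^ jp.2 * truncSum (ones jp.2) jp.1 *
      (indexArray k 0 jp.1 / ((jp.1 : ℝ) + 1)) := by
    rw [kawashima_of_ne x hk, interpolate, Finset.sum_range_zero, zero_add, ← e1.tsum_eq,
      ← tsum_mul_left]
    refine tsum_congr fun j => ?_
    rw [newtonCoeff]
    ring
  rw [e3, ← hasSum_nat_add_iff' 1]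
  have : ∑ i ∈ Finset.range 1, taylorCoeff (toSum k) i * x ^ i = 0 := by
    simp [taylorCoeff, zetaDual_zero]
  rw [this, sub_zero]
  refine (e2.mul_left x).congr_fun fun p => ?_
  rw [taylorCoeff, neg_pow]
  ring

theorem hasSum_extend_kawashima {x : ℝ} (h0 : 0 ≤ x) (h1 : x ≤ 1 / 4) {A : FormalSum}
    (hA : A [] = 0) :
    HasSum (fun m => taylorCoeff A m * x ^ m) (extend (kawashima x · 0) A) := by
  have e : ∀ m, taylorCoeff A m * x ^ m =
      ∑ k ∈ A.support, (A k : ℝ) * (taylorCoeff (toSum k) m * x ^ m) := fun m => by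
    rw [taylorCoeff, zetaDual_eq_extend, extend_sum, Finset.mul_sum, Finset.sum_mul]
    refine Finset.sum_congr rfl fun k _ => ?_
    rw [taylorCoeff]
    ring
  simp only [e, extend_sum]
  refine hasSum_sum fun k hk => (hasSum_kawashima h0 h1 ?_).mul_left _
  rintro rfl
  exact Finsupp.mem_support_iff.1 hk hA

/-! ### Comparison of coefficients -/

/-- The expansions are known only for small positive `x`. Dividing by `x`, the tail stays bounded by
its absolute sum `M` at `r`, so `|a 0| ≤ M * x` for all small `x`. -/
theorem hasSum_pow_tail {r : ℝ} (hr : 0 < r) {a : ℕ → ℝ}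
    (h : ∀ x, 0 < x → x ≤ r → HasSum (fun m => a m * x ^ m) 0) :
    a 0 = 0 ∧ ∀ x, 0 < x → x ≤ r → HasSum (fun m => a (m + 1) * x ^ m) 0 := by
  have htail : ∀ x, 0 < x → x ≤ r → HasSum (fun m => a (m + 1) * x ^ m) (-a 0 / x) := by
    intro x hx hxr
    have h1 := ((hasSum_nat_add_iff' 1).2 (h x hx hxr)).mul_left (1 / x)
    have e : 1 / x * (0 - ∑ i ∈ Finset.range 1, a i * x ^ i) = -a 0 / x := by
      rw [Finset.sum_range_one, pow_zero, mul_one, zero_sub]; ring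
    rw [e] at h1
    refine h1.congr_fun fun m => ?_
    rw [pow_succ]
    field_simp
  have hzero : a 0 = 0 := by
    have hs := (htail r hr le_rfl).summable.norm
    set M := ∑' m, ‖a (m + 1) * r ^ m‖ with hM
    have hM0 : 0 ≤ M := tsum_nonneg fun _ => norm_nonneg _
    have hb : ∀ x, 0 < x → x ≤ r → |a 0| ≤ M * x := by
      intro x hx hxr
      have h1 := htail x hx hxr
      have h2 : ‖-a 0 / x‖ ≤ M := by
        rw [← h1.tsum_eq]
        refine tsum_of_norm_bounded hs.hasSum fun m => ?_
        rw [norm_mul, norm_mul, norm_pow, norm_pow, Real.norm_of_nonneg hx.le,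
          Real.norm_of_nonneg hr.le]
        gcongr
      rwa [norm_div, norm_neg, Real.norm_eq_abs, Real.norm_of_nonneg hx.le, div_le_iff₀ hx] at h2
    by_contra hne
    have hpos : 0 < |a 0| := abs_pos.2 hne
    have h1 := hb (min r (|a 0| / (2 * (M + 1)))) (lt_min hr (by positivity)) (min_le_left _ _)
    have h2 : M * min r (|a 0| / (2 * (M + 1))) ≤ (M + 1) * (|a 0| / (2 * (M + 1))) :=
      mul_le_mul (by linarith) (min_le_right _ _) (by positivity) (by positivity)
    have h3 : (M + 1) * (|a 0| / (2 * (M + 1))) = |a 0| / 2 := by field_simp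
    linarith
  exact ⟨hzero, fun x hx hxr => by simpa [hzero] using htail x hx hxr⟩

theorem eq_zero_of_hasSum_pow_zero {r : ℝ} (hr : 0 < r) {a : ℕ → ℝ}
    (h : ∀ x, 0 < x → x ≤ r → HasSum (fun m => a m * x ^ m) 0) (n : ℕ) : a n = 0 := by
  induction n generalizing a with
  | zero => exact (hasSum_pow_tail hr h).1
  | succ n ih => exact ih (hasSum_pow_tail hr h).2

theorem sum_antidiagonal_taylorCoeff {k l : Index} (hk : k ≠ []) (hl : l ≠ []) (m : ℕ) :
    ∑ pq ∈ Finset.HasAntidiagonal.antidiagonal m,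
      taylorCoeff (toSum k) pq.1 * taylorCoeff (toSum l) pq.2 = taylorCoeff (barStuffle k l) m := by
  rw [← sub_eq_zero]
  refine eq_zero_of_hasSum_pow_zero (r := 1 / 4) (by norm_num) (a := fun m =>
    ∑ pq ∈ Finset.HasAntidiagonal.antidiagonal m,
      taylorCoeff (toSum k) pq.1 * taylorCoeff (toSum l) pq.2 - taylorCoeff (barStuffle k l) m)
    (fun x hx hxr => ?_) m
  have hK := hasSum_kawashima hx.le hxr hk
  have hL := hasSum_kawashima hx.le hxr hl
  have hQ := hasSum_extend_kawashima hx.le hxr (A := barStuffle k l)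
    (quasiShuffle_apply_nil _ hk hl)
  rw [kawashima_mul hx.le (by linarith)] at hQ
  have hs := (summable_norm_sum_mul_antidiagonal_of_summable_norm hK.summable.norm
    hL.summable.norm).of_norm.hasSum
  rw [← tsum_mul_tsum_eq_tsum_sum_antidiagonal_of_summable_norm hK.summable.norm
    hL.summable.norm, hK.tsum_eq, hL.tsum_eq] at hs
  have hd := hs.sub hQ
  rw [sub_self] at hd
  refine hd.congr_fun fun n => ?_
  rw [sub_mul, Finset.sum_mul]
  congr 1
  refine Finset.sum_congr rfl fun pq hpq => ?_
  rw [← Finset.HasAntidiagonal.mem_antidiagonal.1 hpq, pow_add]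
  ring

end

end MZV

/-! ### Kawashima's relation -/

theorem corollary3p2 (m : ℕ) (hm : 1 ≤ m) (k l : MZV.Index) (hk : k ≠ []) (hl : l ≠ []) :
    (∀ p : ℕ, 1 ≤ p →
      MZV.Converges (MZV.circledast (MZV.ones p) (MZV.star (MZV.hoffmanDual (MZV.toSum k)))) ∧
      MZV.Converges (MZV.circledast (MZV.ones p) (MZV.star (MZV.hoffmanDual (MZV.toSum l)))) ∧
      MZV.Converges
        (MZV.circledast (MZV.ones p) (MZV.star (MZV.hoffmanDual (MZV.barStuffle k l))))) ∧
    ∑ pq ∈ (Finset.HasAntidiagonal.antidiagonal m).filter (fun pq => 1 ≤ pq.1 ∧ 1 ≤ pq.2),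
        MZV.zeta (MZV.circledast (MZV.ones pq.1) (MZV.star (MZV.hoffmanDual (MZV.toSum k)))) *
        MZV.zeta (MZV.circledast (MZV.ones pq.2) (MZV.star (MZV.hoffmanDual (MZV.toSum l)))) =
      -MZV.zeta
        (MZV.circledast (MZV.ones m) (MZV.star (MZV.hoffmanDual (MZV.barStuffle k l)))) := by
  refine ⟨fun p _ => ⟨MZV.converges_circledast _ _, MZV.converges_circledast _ _,
    MZV.converges_circledast _ _⟩, ?_⟩
  change ∑ pq ∈ (Finset.HasAntidiagonal.antidiagonal m).filter (fun pq => 1 ≤ pq.1 ∧ 1 ≤ pq.2),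
    MZV.zetaDual pq.1 (MZV.toSum k) * MZV.zetaDual pq.2 (MZV.toSum l) =
      -MZV.zetaDual m (MZV.barStuffle k l)
  -- The end terms `p = 0` and `q = 0` vanish through the dummy value of `circledastIndex` at the
  -- empty index, matching `F_k(0) = 0`.
  rw [Finset.sum_filter_of_ne]
  · have h := MZV.sum_antidiagonal_taylorCoeff hk hl m
    have e : ∀ pq ∈ Finset.HasAntidiagonal.antidiagonal m,
        MZV.taylorCoeff (MZV.toSum k) pq.1 * MZV.taylorCoeff (MZV.toSum l) pq.2 =
        (-1) ^ m * (MZV.zetaDual pq.1 (MZV.toSum k) * MZV.zetaDual pq.2 (MZV.toSum l)) := by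
      intro pq hpq
      rw [MZV.taylorCoeff, MZV.taylorCoeff, ← Finset.HasAntidiagonal.mem_antidiagonal.1 hpq]
      ring
    -- The signs are `(-1) ^ m` for the product and `(-1) ^ (m + 1)` on the right, which leaves the
    -- minus sign of the relation.
    rw [Finset.sum_congr rfl e, ← Finset.mul_sum, MZV.taylorCoeff, pow_succ] at h
    apply mul_left_cancel₀ (pow_ne_zero m (by norm_num : (-1 : ℝ) ≠ 0))
    rw [h]
    ring
  · rintro ⟨p, q⟩ - hne
    refine ⟨Nat.one_le_iff_ne_zero.2 ?_, Nat.one_le_iff_ne_zero.2 ?_⟩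
    · rintro rfl
      exact hne (by rw [MZV.zetaDual_zero, zero_mul])
    · rintro rfl
      exact hne (by rw [MZV.zetaDual_zero, mul_zero])
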